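/- Let $k$ be an algebraically closed field of characteristic $\neq 2,3$ and let $\zeta\in k$ be a primitive cube root of unity. All curves are smooth, complete and irreducible over $k$; for a surjective morphism $\tau: C\to C'$ of curves, $\mathrm{Bran}(\tau)\subset C'$ denotes the image of the set of points of $C$ at which the local ramification index of $\tau$ is greater than $1$. For $\lambda\in k$ with $\lambda^3\neq -27$ let $E_\lambda\subset\mathbb P^2$ be the smooth plane cubic $$x^3+y^3+z^3+\lambda xyz=0 .$$ Let $$\pi(\mathsf T)=\{(0:1),\ (1:-\zeta),\ (1:-\zeta^2),\ (1:-1),\ (1:0)\}\subset\mathbb P^1$$ (the image of the set $\mathsf T$ of the nine common $3$-torsion points of the cubics $E_\lambda$ under the projection $\pi:(x:y:z)\mapsto (x+z:y)$, where at the centre $(1:0:-1)$ of the projection $\pi$ is extended along $E_0$). Let $\pi_0': E_0'\to\mathbb P^1$ be a double cover whose branch locus consists of four of the five points of $\pi(\mathsf T)$. Let $\iota: C\to E_\lambda$ be a double cover such that over at least one point of $\mathrm{Bran}(\iota)$ all local ramification indices of $\iota$ are even. Then there exist an unramified cover $\tilde C\to C$ and a surjective morphism $\tilde\iota:\tilde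 C\to E_0'$ such that over at least one point of $\mathrm{Bran}(\tilde\iota)\subset E_0'$ all local ramification indices of $\tilde\iota$ are even. -/

import Mathlib

open Polynomial

universe u

noncomputable section

set_option linter.style.haveILetI false

/-- A smooth complete irreducible curve over an algebraically closed field `k`, presented as the
abstract nonsingular curve attached to its function field: a finitely generated field extension of
`k` of transcendence degree one.  The points of the curve are the (discrete) valuation rings of the
function field that contain `k`, see `SmoothCurve.Point`; a non-constant (equivalently: surjective,
equivalently: finite) regular map is given by the pullback of functions, see
`SmoothCurve.Cover`. -/
structure SmoothCurve (k : Type u) [Field k] where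
  /-- The field of rational functions on the curve. -/
  FunctionField : Type u
  [field : Field FunctionField]
  [algebra : Algebra k FunctionField]
  [essFiniteType : Algebra.EssFiniteType k FunctionField]
  trdeg_eq_one : Algebra.trdeg k FunctionField = 1

namespace SmoothCurve

variable {k : Type u} [Field k]

attribute [instance] SmoothCurve.field SmoothCurve.algebra SmoothCurve.essFiniteType

/-- A (closed) point of the curve `C`, given by its local ring: a valuation ring of the function
field which contains `k` and is not the whole function field. -/
@[ext]
structure Point (C : SmoothCurve k) where
  /-- The local ring of the curve at the point. -/
  localRing : ValuationSubring C.FunctionField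
  algebraMap_mem : ∀ c : k, algebraMap k C.FunctionField c ∈ localRing
  ne_top : localRing ≠ ⊤

/-- A surjective regular map `C → D` of smooth complete curves over `k`, given by the pullback of
rational functions. -/
structure Cover (C D : SmoothCurve k) where
  /-- The pullback of rational functions on `D` to rational functions on `C`. -/
  pullback : D.FunctionField →ₐ[k] C.FunctionField

namespace Cover

variable {C D : SmoothCurve k} (f : Cover C D)

/-- The function field of `C` as an extension of the function field of `D`. -/
abbrev extension : Algebra D.FunctionField C.FunctionField := f.pullback.toRingHom.toAlgebra

/-- The extension of function fields defined by a cover is algebraic. -/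
theorem isAlgebraic :
    letI := f.extension
    Algebra.IsAlgebraic D.FunctionField C.FunctionField := by
  letI := f.extension
  haveI : IsScalarTower k D.FunctionField C.FunctionField :=
    IsScalarTower.of_algebraMap_eq fun c => (f.pullback.commutes c).symm
  have h := trdeg_add_eq k D.FunctionField (A := C.FunctionField)
  rw [C.trdeg_eq_one, D.trdeg_eq_one] at h
  rw [← trdeg_eq_zero_iff]
  exact Cardinal.eq_of_add_eq_add_left (a := 1) (by rw [h, add_zero]) Cardinal.one_lt_aleph0

/-- The extension of function fields defined by a cover is finite. -/
theorem finite :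
    letI := f.extension
    Module.Finite D.FunctionField C.FunctionField := by
  letI := f.extension
  haveI : IsScalarTower k D.FunctionField C.FunctionField :=
    IsScalarTower.of_algebraMap_eq fun c => (f.pullback.commutes c).symm
  haveI := f.isAlgebraic
  haveI := Algebra.EssFiniteType.of_comp k D.FunctionField C.FunctionField
  exact Algebra.finite_of_essFiniteType_of_isAlgebraic

/-- The image of a point of `C` under a cover `C → D`. -/
def onPoints (Q : C.Point) : D.Point where
  localRing := Q.localRing.comap f.pullback.toRingHom
  algebraMap_mem c := by
    rw [ValuationSubring.mem_comap]
    simpa using Q.algebraMap_mem c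
  ne_top h := by
    letI := f.extension
    haveI := f.isAlgebraic
    refine Q.ne_top (top_le_iff.mp fun x _ => ?_)
    have hD : ∀ y : D.FunctionField, algebraMap D.FunctionField C.FunctionField y ∈ Q.localRing :=
      fun y => ValuationSubring.mem_comap.mp (h ▸ ValuationSubring.mem_top y)
    have hx : IsIntegral Q.localRing x := by
      letI : Algebra D.FunctionField Q.localRing :=
        ((algebraMap D.FunctionField C.FunctionField).codRestrict Q.localRing.toSubring hD).toAlgebra
      haveI : IsScalarTower D.FunctionField Q.localRing C.FunctionField :=
        IsScalarTower.of_algebraMap_eq fun _ => rfl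
      exact (Algebra.IsIntegral.isIntegral (R := D.FunctionField) x).tower_top
    obtain ⟨y, hy⟩ := IsIntegrallyClosed.isIntegral_iff.mp hx
    exact hy ▸ y.2

/-- The homomorphism `𝒪_{D, f(Q)} → 𝒪_{C, Q}` of local rings induced by a cover `f`. -/
def localHom (Q : C.Point) : (f.onPoints Q).localRing →+* Q.localRing :=
  (f.pullback.toRingHom.comp (f.onPoints Q).localRing.subtype).codRestrict
    Q.localRing.toSubring fun x => x.2

/-- The local ramification index `e_Q(f)`: the largest `n` such that the maximal ideal of
`𝒪_{D, f(Q)}` is mapped into the `n`-th power of the maximal ideal of `𝒪_{C, Q}`. -/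
def ramificationIndex (Q : C.Point) : ℕ :=
  letI := (f.localHom Q).toAlgebra
  Ideal.ramificationIdx' (IsLocalRing.maximalIdeal (f.onPoints Q).localRing)
    (IsLocalRing.maximalIdeal Q.localRing)

/-- The degree of a cover. -/
def degree : ℕ :=
  letI := f.extension
  Module.finrank D.FunctionField C.FunctionField

/-- The ramification locus `Ram(f) ⊆ C`. -/
def ramificationLocus : Set C.Point := {Q | 1 < f.ramificationIndex Q}

/-- The branch locus `Bran(f) = f(Ram(f)) ⊆ D`. -/
def branchLocus : Set D.Point := f.onPoints '' f.ramificationLocus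

/-- Over the point `P` of `D`, all local ramification indices of `f` are even. -/
def EvenOver (P : D.Point) : Prop :=
  ∀ Q : C.Point, f.onPoints Q = P → Even (f.ramificationIndex Q)

/-- `f` is an unramified (that is, finite étale) cover: it is separable and all its local
ramification indices are equal to one. -/
def IsUnramified : Prop :=
  (letI := f.extension
   Algebra.IsSeparable D.FunctionField C.FunctionField) ∧
  ∀ Q : C.Point, f.ramificationIndex Q = 1

end Cover

section ProjectiveLine

variable (k)

theorem trdeg_ratFunc : Algebra.trdeg k (RatFunc k) = 1 := by
  have h := trdeg_add_eq k k[X] (A := RatFunc k)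
  haveI : Algebra.IsAlgebraic k[X] (RatFunc k) :=
    IsLocalization.isAlgebraic (RatFunc k) (nonZeroDivisors k[X])
  have h' : Algebra.trdeg k[X] (RatFunc k) = 0 := trdeg_eq_zero
  rw [h', Polynomial.trdeg_of_isDomain] at h
  simpa using h.symm

theorem essFiniteType_ratFunc : Algebra.EssFiniteType k (RatFunc k) := by
  haveI : Algebra.EssFiniteType k[X] (RatFunc k) :=
    Algebra.EssFiniteType.of_isLocalization (RatFunc k) (nonZeroDivisors k[X])
  exact Algebra.EssFiniteType.comp k k[X] (RatFunc k)

/-- The projective line over `k`, with function field `k(t)`, where `t` is the quotient of the first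
by the second homogeneous coordinate. -/
def projectiveLine : SmoothCurve k where
  FunctionField := RatFunc k
  essFiniteType := essFiniteType_ratFunc k
  trdeg_eq_one := trdeg_ratFunc k

variable {k}

namespace projectiveLine

/-- The prime ideal `(t - a)` of `k[t]`. -/
def primeAt (a : k) : IsDedekindDomain.HeightOneSpectrum k[X] where
  asIdeal := Ideal.span {X - C a}
  isPrime := (Ideal.span_singleton_prime (X_sub_C_ne_zero a)).mpr (prime_X_sub_C a)
  ne_bot := by simpa using X_sub_C_ne_zero a

/-- The point `t = a` of the projective line. -/
def affinePoint (a : k) : (projectiveLine k).Point where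
  localRing := ((primeAt a).valuation (RatFunc k)).valuationSubring
  algebraMap_mem c := by
    change (primeAt a).valuation (RatFunc k) (algebraMap k (RatFunc k) c) ≤ 1
    rw [IsScalarTower.algebraMap_apply k k[X] (RatFunc k)]
    exact (primeAt a).valuation_le_one _
  ne_top := by
    intro h
    exact (Valuation.valuationSubring_eq_top_iff _).mp h inferInstance

open Classical in
/-- The point `t = ∞` of the projective line. -/
def pointAtInfinity : (projectiveLine k).Point where
  localRing := (RatFunc.inftyValuation k).valuationSubring
  algebraMap_mem c := by
    change RatFunc.inftyValuation k (algebraMap k (RatFunc k) c) ≤ 1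
    by_cases hc : c = 0
    · simp [hc]
    · exact (RatFunc.inftyValuation.C k hc).le
  ne_top := by
    intro h
    exact (Valuation.valuationSubring_eq_top_iff _).mp h inferInstance

open Classical in
/-- The point of the projective line with homogeneous coordinates `(a : b)`, for
`(a, b) ≠ (0, 0)`. -/
def point (a b : k) : (projectiveLine k).Point :=
  if b = 0 then pointAtInfinity else affinePoint (a / b)

end projectiveLine

end ProjectiveLine

section Hesse

/-- The equation `X ^ 3 + Y ^ 3 + 1 + lam * X * Y` of the affine part `z = 1` of the cubic
`x ^ 3 + y ^ 3 + z ^ 3 + lam * x * y * z = 0`, as a polynomial in `Y` over `k[X]`. -/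
def hessePolynomial (lam : k) : k[X][X] :=
  X ^ 3 + C (C lam * X) * X + C (X ^ 3 + 1)

/-- The equation of a smooth Hesse cubic is irreducible. -/
theorem irreducible_hessePolynomial {lam : k} (h : lam ^ 3 + 27 ≠ 0) :
    Irreducible ((hessePolynomial lam).map (algebraMap k[X] (RatFunc k))) := by
  have hdeg : (hessePolynomial lam).natDegree = 3 := by unfold hessePolynomial; compute_degree!
  have hmon : (hessePolynomial lam).Monic := by unfold hessePolynomial; monicity!
  rw [← hmon.irreducible_iff_irreducible_map_fraction_map,
    hmon.irreducible_iff_roots_eq_zero_of_degree_le_three (by omega) (by omega)]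
  refine Multiset.eq_zero_of_forall_notMem fun f hf => h ?_
  have hf' : f ^ 3 + C lam * X * f + (X ^ 3 + 1) = 0 := by
    simpa [hessePolynomial] using (mem_roots'.mp hf).2
  have hd : f.natDegree ≤ 1 := by
    by_contra! hlt
    have h1 : (f ^ 3).natDegree = 3 * f.natDegree := natDegree_pow f 3
    have h2 : f ^ 3 = -(C lam * X * f) - (X ^ 3 + 1) := by linear_combination hf'
    have h3 : (-(C lam * X * f) - (X ^ 3 + 1)).natDegree ≤ max (1 + f.natDegree) 3 := by
      refine (natDegree_sub_le _ _).trans (max_le_max ?_ ?_)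
      · rw [natDegree_neg]
        refine natDegree_mul_le.trans (Nat.add_le_add_right ?_ _)
        compute_degree
      · compute_degree
    rw [← h2, h1] at h3
    omega
  obtain ⟨a, b, rfl⟩ := exists_eq_X_add_C_of_natDegree_le_one hd
  have key : ∀ p q r s : k, C p * X ^ 3 + C q * X ^ 2 + C r * X + C s = 0 →
      p = 0 ∧ q = 0 ∧ s = 0 := fun p q r s e =>
    ⟨by simpa [coeff_X, coeff_C, coeff_X_pow] using congrArg (coeff · 3) e,
      by simpa [coeff_X, coeff_C, coeff_X_pow] using congrArg (coeff · 2) e,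
      by simpa using congrArg (coeff · 0) e⟩
  obtain ⟨e3, e2, e0⟩ := key (a ^ 3 + 1) (3 * a ^ 2 * b + lam * a) (3 * a * b ^ 2 + lam * b)
    (b ^ 3 + 1) (by
      rw [← hf']
      simp only [map_add, map_mul, map_pow, map_one, map_ofNat]
      ring)
  have ha : a ≠ 0 := by rintro rfl; simp at e3
  have hl : lam = -(3 * a * b) := by
    apply mul_right_cancel₀ ha
    linear_combination e2
  rw [hl]
  linear_combination -27 * b ^ 3 * e3 + 27 * e0

/-- The function field of the plane cubic `x ^ 3 + y ^ 3 + z ^ 3 + lam * x * y * z = 0`. -/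
abbrev HesseFunctionField (lam : k) : Type u :=
  AdjoinRoot ((hessePolynomial lam).map (algebraMap k[X] (RatFunc k)))

/-- The smooth plane cubic `E_lam : x ^ 3 + y ^ 3 + z ^ 3 + lam * x * y * z = 0`, where
`lam ^ 3 ≠ -27`. -/
def hesseCubic (lam : k) (h : lam ^ 3 + 27 ≠ 0) : SmoothCurve k :=
  haveI : Fact (Irreducible ((hessePolynomial lam).map (algebraMap k[X] (RatFunc k)))) :=
    ⟨irreducible_hessePolynomial h⟩
  { FunctionField := HesseFunctionField lam
    essFiniteType :=
      haveI := essFiniteType_ratFunc k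
      Algebra.EssFiniteType.comp k (RatFunc k) (HesseFunctionField lam)
    trdeg_eq_one := by
      haveI : Module.Finite (RatFunc k) (HesseFunctionField lam) :=
        (AdjoinRoot.powerBasis (irreducible_hessePolynomial h).ne_zero).finite
      have h' := trdeg_add_eq k (RatFunc k) (A := HesseFunctionField lam)
      rw [trdeg_ratFunc, trdeg_eq_zero, add_zero] at h'
      exact h'.symm }

/-- The subset `{(0 : 1), (1 : -ζ), (1 : -ζ ^ 2), (1 : -1), (1 : 0)}` of the projective line, for a
primitive cube root of unity `ζ`.  It is the image `π(T)` of the set `T` of the nine common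
`3`-torsion points (flexes) of the Hesse cubics under the projection
`π : (x : y : z) ↦ (x + z : y)`, where at the centre `(1 : 0 : -1)` of the projection `π` is
extended along the Fermat cubic `x ^ 3 + y ^ 3 + z ^ 3 = 0`, which gives the value `(0 : 1)`. -/
def flexImages (ζ : k) : Set (projectiveLine k).Point :=
  {projectiveLine.point 0 1, projectiveLine.point 1 (-ζ), projectiveLine.point 1 (-ζ ^ 2),
    projectiveLine.point 1 (-1), projectiveLine.point 1 0}

end Hesse

end SmoothCurve

end

set_option linter.style.haveILetI false

noncomputable section

namespace SmoothCurve

variable {k : Type u} [Field k]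

/-! Write H_l for x³ + y³ + 1 + l x y = 0 and T_l for y² + (l w + 1) y + w³ = 0. If μ³ = l³ + 27 and
l' = -3 l / μ, then H_l is isomorphic to T_{l'} (`hesse_to_tripling`), while a cube root of y on T_l
gives an unramified map H_l → T_l of degree 3 (`exists_hesse_of_tripling`). Since l ↦ l' is an
involution, two such steps lead from T_{l'} back to T_{l'}; they play the role of multiplication by
3.

On T_{l'} the function w has a single pole, a double one. Put it at the point over which ι is evenly
ramified: on C the poles of w then have order divisible by 4 (`exists_isPow_four_of_evenOver`).
Under the tripling the point at infinity pulls back to the nine flexes of H_l. There t = x + y takes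
each of the values -1, -ζ, -ζ², ∞ at two flexes, without ramification, and the value l/3 at the
remaining flex, with ramification 2. So on an unramified cover of C the function t is evenly
ramified over the first four values and has multiplicities divisible by 4 over l/3
(`exists_tripling`).

The first four values do not depend on l. Hence adjoining a square root of t³ + 1 is unramified and
gives a map to T_0; as l³ ≠ -27, the value l/3 is not a branch point of T_0 → ℙ¹, so the
multiplicities over it survive, and a reflection moves a point above it to infinity
(`exists_cover_of_isPow`). A second tripling, now with l = 0, has l/3 = 0, so the new t is evenly
ramified over all five points of `flexImages ζ`.

Finally E₀' → ℙ¹ is branched over four of these points, so its normalised fibre product with t is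
unramified over the source of t, and the even ramification over the fifth point passes to any point
of E₀' above it. All unramified covers are obtained by `exists_isImmediate_pow_eq`: a root of prime
order p of a function whose valuations are all divisible by p. -/

/-- Over an algebraically closed field, an element is transcendental as soon as it is not a
constant. -/
theorem transcendental_of_notMem_range [IsAlgClosed k] {F : Type*} [Field F] [Algebra k F] {a : F}
    (ha : a ∉ (algebraMap k F).range) : Transcendental k a := by
  intro h
  exact ha (minpoly.mem_range_of_degree_eq_one k a
    (IsAlgClosed.degree_eq_one_of_irreducible k (minpoly.irreducible h.isIntegral)))

/-! ### Points as discrete valuations with residue field `k` -/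

variable {C D : SmoothCurve k}

/-- The valuation of the function field at a point of the curve. -/
abbrev Point.val (Q : C.Point) : Valuation C.FunctionField Q.localRing.ValueGroup :=
  Q.localRing.valuation

namespace Point

variable (Q : C.Point)

theorem val_algebraMap_le_one (c : k) : Q.val (algebraMap k C.FunctionField c) ≤ 1 :=
  (Q.localRing.valuation_le_one_iff _).mpr (Q.algebraMap_mem c)

theorem val_algebraMap {c : k} (hc : c ≠ 0) : Q.val (algebraMap k C.FunctionField c) = 1 := by
  refine le_antisymm (Q.val_algebraMap_le_one c) ?_
  have h := Q.val_algebraMap_le_one c⁻¹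
  rw [map_inv₀, map_inv₀] at h
  refine (inv_le_one₀ ?_).mp h
  exact zero_lt_iff.mpr ((Valuation.ne_zero_iff _).mpr (by simpa using hc))

theorem exists_val_lt_one : ∃ t : C.FunctionField, t ≠ 0 ∧ Q.val t < 1 := by
  by_contra! h
  refine Q.ne_top (top_le_iff.mp fun x _ => ?_)
  rw [← Q.localRing.valuation_le_one_iff]
  by_cases hx : x = 0
  · simp [hx]
  · have := h x⁻¹ (inv_ne_zero hx)
    rw [map_inv₀] at this
    exact (one_le_inv₀ (zero_lt_iff.mpr ((Valuation.ne_zero_iff _).mpr hx))).mp this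

theorem notMem_range_of_val_lt_one {t : C.FunctionField} (ht : t ≠ 0) (h : Q.val t < 1) :
    t ∉ (algebraMap k C.FunctionField).range := by
  rintro ⟨c, rfl⟩
  have hc : c ≠ 0 := by rintro rfl; simp at ht
  exact h.ne (Q.val_algebraMap hc)

theorem notMem_range_of_one_lt_val {t : C.FunctionField} (h : 1 < Q.val t) :
    t ∉ (algebraMap k C.FunctionField).range := by
  rintro ⟨c, rfl⟩
  exact h.not_ge (Q.val_algebraMap_le_one c)

end Point

/-- The cover of the projective line defined by a transcendental function. -/
def coverOfTranscendental (t : C.FunctionField) (ht : Transcendental k t) :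
    Cover C (projectiveLine k) where
  pullback := RatFunc.liftAlgHom (aeval t) (by
    intro p hp
    rw [Submonoid.mem_comap, mem_nonZeroDivisors_iff_ne_zero]
    exact fun h => nonZeroDivisors.ne_zero hp ((transcendental_iff.mp ht) p h))

theorem coverOfTranscendental_algebraMap (t : C.FunctionField) (ht : Transcendental k t) (p : k[X]) :
    (coverOfTranscendental t ht).pullback (algebraMap k[X] (RatFunc k) p) = aeval t p := by
  have := RatFunc.liftAlgHom_apply (S := k) (aeval t : k[X] →ₐ[k] C.FunctionField) (by
    intro p hp
    rw [Submonoid.mem_comap, mem_nonZeroDivisors_iff_ne_zero]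
    exact fun h => nonZeroDivisors.ne_zero hp ((transcendental_iff.mp ht) p h))
    (algebraMap k[X] (RatFunc k) p)
  change RatFunc.liftAlgHom _ _ _ = _
  rw [this]
  simp

/-- The coordinate function on the projective line. -/
def projectiveLine.coord : (projectiveLine k).FunctionField := (RatFunc.X : RatFunc k)

theorem coverOfTranscendental_coord (t : C.FunctionField) (ht : Transcendental k t) :
    (coverOfTranscendental t ht).pullback projectiveLine.coord = t :=
  (congrArg _ (RatFunc.algebraMap_X (K := k)).symm).trans
    ((coverOfTranscendental_algebraMap t ht X).trans (aeval_X t))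

/-- The number of functions regular at a point and linearly independent modulo a non-zero function
vanishing there is bounded. -/
theorem Point.exists_card_le [IsAlgClosed k] (Q : C.Point) {t : C.FunctionField} (ht0 : t ≠ 0)
    (ht : Q.val t < 1) :
    ∃ n : ℕ, ∀ m : ℕ, ∀ a : Fin m → C.FunctionField,
      (∀ i, Q.val (a i) ≤ 1) →
      (∀ c : Fin m → k, Q.val (∑ i, algebraMap k _ (c i) * a i) ≤ Q.val t → c = 0) → m ≤ n := by
  have htr := transcendental_of_notMem_range (Q.notMem_range_of_val_lt_one ht0 ht)
  set f := coverOfTranscendental t htr with hf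
  letI : Algebra k[X] C.FunctionField := (aeval t : k[X] →ₐ[k] C.FunctionField).toRingHom.toAlgebra
  letI : Algebra (RatFunc k) C.FunctionField := f.extension
  haveI : IsScalarTower k[X] (RatFunc k) C.FunctionField :=
    IsScalarTower.of_algebraMap_eq fun p => (coverOfTranscendental_algebraMap t htr p).symm
  haveI : Module.Finite (RatFunc k) C.FunctionField := f.finite
  refine ⟨Module.finrank (RatFunc k) C.FunctionField, fun m a ha hc => ?_⟩
  have hsmul : ∀ (p : k[X]) (x : C.FunctionField), p • x = aeval t p * x := fun p x => rfl
  -- The constant terms of a relation over k[t] form a relation over k modulo t, hence vanish;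
  -- dividing by t and repeating makes every coefficient divisible by all powers of X.
  have key : ∀ n : ℕ, ∀ p : Fin m → k[X], ∑ i, p i • a i = 0 → ∀ i, X ^ n ∣ p i := by
    intro n
    induction n with
    | zero => intro p _ i; simp
    | succ n ih =>
      intro p hp
      have h0 : (fun i => (p i).coeff 0) = 0 := by
        apply hc
        have h1 : ∀ i, p i • a i = algebraMap k _ ((p i).coeff 0) * a i +
            t * (aeval t (p i).divX * a i) := by
          intro i
          rw [hsmul]
          conv_lhs => rw [← (p i).divX_mul_X_add]
          simp only [map_add, map_mul, aeval_X, aeval_C]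
          ring
        have h2 : ∑ i, algebraMap k C.FunctionField ((p i).coeff 0) * a i =
            t * (-∑ i, aeval t (p i).divX * a i) := by
          simp only [h1, Finset.sum_add_distrib, ← Finset.mul_sum] at hp
          linear_combination hp
        rw [h2, map_mul]
        have h3 : Q.val (-∑ i, aeval t (p i).divX * a i) ≤ 1 := by
          rw [Valuation.map_neg]
          refine Valuation.map_sum_le _ fun i _ => ?_
          rw [map_mul]
          refine mul_le_one' ?_ (ha i)
          rw [Q.localRing.valuation_le_one_iff, aeval_eq_sum_range]
          refine sum_mem fun j _ => ?_
          rw [Algebra.smul_def]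
          exact mul_mem (Q.algebraMap_mem _)
            (pow_mem ((Q.localRing.valuation_le_one_iff _).mp ht.le) _)
        exact mul_le_of_le_one_right' h3
      have hX : ∀ i, X ∣ p i := fun i => X_dvd_iff.mpr (congrFun h0 i)
      choose q hq using hX
      have hq' : ∑ i, q i • a i = 0 := by
        have : t * ∑ i, q i • a i = 0 := by
          rw [Finset.mul_sum, ← hp]
          refine Finset.sum_congr rfl fun i _ => ?_
          rw [hsmul, hsmul, hq i, map_mul, aeval_X]; ring
        exact (mul_eq_zero.mp this).resolve_left ht0
      intro i
      rw [hq i, pow_succ']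
      exact mul_dvd_mul_left X (ih q hq' i)
  have hli : LinearIndependent k[X] a := by
    rw [Fintype.linearIndependent_iff]
    intro p hp i
    by_contra hne
    have := natDegree_le_of_dvd (key ((p i).natDegree + 1) p hp i) hne
    simp at this
  have hli' := (LinearIndependent.iff_fractionRing k[X] (RatFunc k)).mp hli
  simpa using hli'.fintype_card_le_finrank

/-- The residue field at a point of a curve over an algebraically closed field is the base field. -/
theorem Point.exists_val_sub_lt_one [IsAlgClosed k] (Q : C.Point) {y : C.FunctionField}
    (hy : Q.val y ≤ 1) : ∃ c : k, Q.val (y - algebraMap k _ c) < 1 := by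
  by_contra! hne
  obtain ⟨t, ht0, ht⟩ := Q.exists_val_lt_one
  obtain ⟨n, hn⟩ := Q.exists_card_le ht0 ht
  -- If no y - c vanishes at the point, every non-zero polynomial in y is a product of units. The
  -- powers of y are then independent modulo t, beyond any bound.
  have hunit : ∀ p : k[X], p ≠ 0 → Q.val (aeval y p) = 1 := by
    intro p hp
    have hs := (IsAlgClosed.splits p).eq_prod_roots
    rw [hs, map_mul, map_mul, aeval_C, Q.val_algebraMap (leadingCoeff_ne_zero.mpr hp), one_mul]
    have : ∀ s : Multiset k, Q.val (aeval y (s.map fun a => X - Polynomial.C a).prod) = 1 := by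
      intro s
      induction s using Multiset.induction_on with
      | empty => simp
      | cons a s ih =>
        rw [Multiset.map_cons, Multiset.prod_cons, map_mul, map_mul, ih, mul_one]
        simp only [map_sub, aeval_X, aeval_C]
        refine le_antisymm ?_ (hne a)
        exact (Valuation.map_sub _ _ _).trans (max_le hy (Q.val_algebraMap_le_one a))
    exact this _
  have := hn (n + 1) (fun i => y ^ (i : ℕ)) (fun i => by rw [map_pow]; exact pow_le_one' hy _) ?_
  · omega
  intro c hc
  beta_reduce at hc
  by_contra hc0
  have hp : (∑ i : Fin (n + 1), Polynomial.C (c i) * X ^ (i : ℕ)) ≠ 0 := by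
    intro h0
    apply hc0
    funext j
    have := congrArg (coeff · (j : ℕ)) h0
    simpa [coeff_C_mul, coeff_X_pow, Fin.val_inj] using this
  have h1 := hunit _ hp
  simp only [map_sum, map_mul, aeval_C, map_pow, aeval_X] at h1
  exact (hc.trans_lt ht).ne h1

end SmoothCurve

namespace SmoothCurve

variable {k : Type u} [Field k] {C D : SmoothCurve k}

namespace Point

theorem val_ne_zero (Q : C.Point) {f : C.FunctionField} (hf : f ≠ 0) : Q.val f ≠ 0 :=
  (Valuation.ne_zero_iff _).mpr hf

theorem val_pos (Q : C.Point) {f : C.FunctionField} (hf : f ≠ 0) : 0 < Q.val f :=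
  zero_lt_iff.mpr (Q.val_ne_zero hf)

/-- Functions with distinct values are linearly independent over k, and remain so modulo t when
their values exceed that of t; `exists_card_le` bounds their number. -/
theorem finite_val_Ioc [IsAlgClosed k] (Q : C.Point) {t : C.FunctionField} (ht0 : t ≠ 0)
    (ht : Q.val t < 1) : (Set.Ioc (Q.val t) 1).Finite := by
  obtain ⟨n, hn⟩ := Q.exists_card_le ht0 ht
  by_contra hinf
  obtain ⟨s, hs, hcard⟩ := Set.Infinite.exists_subset_card_eq hinf (n + 1)
  have hsurj := fun γ => Q.localRing.valuation_surjective γ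
  choose x hx using hsurj
  let e := s.equivFin
  rw [hcard] at e
  have hmem : ∀ i, Q.val t < Q.val (x (e.symm i)) ∧ Q.val (x (e.symm i)) ≤ 1 := fun i => by
    rw [Point.val, hx]; exact hs (e.symm i).2
  have := hn (n + 1) (fun i => x (e.symm i)) (fun i => (hmem i).2) ?_
  · omega
  intro c hc
  by_contra hc0
  classical
  have hne : (Finset.univ.filter fun i => c i ≠ 0).Nonempty := by
    obtain ⟨i, hi⟩ := Function.ne_iff.mp hc0
    exact ⟨i, by simpa using hi⟩
  obtain ⟨j, hj, hmax⟩ := Finset.exists_max_image _ (fun i => Q.val (x (e.symm i))) hne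
  simp only [Finset.mem_filter, Finset.mem_univ, true_and] at hj hmax
  have hval : ∀ i, c i ≠ 0 → Q.val (algebraMap k _ (c i) * x (e.symm i)) =
      Q.val (x (e.symm i)) := fun i hi => by rw [map_mul, Q.val_algebraMap hi, one_mul]
  have hlt : Q.val (∑ i ∈ Finset.univ.erase j, algebraMap k _ (c i) * x (e.symm i)) <
      Q.val (x (e.symm j)) := by
    refine Valuation.map_sum_lt _ ?_ fun i hi => ?_
    · exact ((zero_le).trans_lt (hmem j).1).ne'
    · by_cases hci : c i = 0
      · simpa [hci] using (zero_le).trans_lt (hmem j).1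
      · rw [hval i hci]
        refine lt_of_le_of_ne (hmax i hci) fun heq => (Finset.ne_of_mem_erase hi) ?_
        rw [Point.val, hx, hx] at heq
        exact e.symm.injective (Subtype.ext heq)
  rw [← Finset.add_sum_erase _ _ (Finset.mem_univ j),
    Valuation.map_add_eq_of_lt_left _ (by rwa [hval j hj]), hval j hj] at hc
  exact hc.not_gt (hmem j).1

/-- A uniformizing parameter at a point. -/
structure IsUniformizer (Q : C.Point) (ϖ : C.FunctionField) : Prop where
  ne_zero : ϖ ≠ 0
  lt_one : Q.val ϖ < 1
  exists_zpow : ∀ f : C.FunctionField, f ≠ 0 → ∃ n : ℤ, Q.val f = Q.val ϖ ^ n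

/-- By finiteness there is a largest value below 1. Dividing a function by a suitable power of an
element with this value leaves a value in the gap up to 1, so a unit. -/
theorem exists_isUniformizer [IsAlgClosed k] (Q : C.Point) : ∃ ϖ, Q.IsUniformizer ϖ := by
  obtain ⟨t, ht0, ht⟩ := Q.exists_val_lt_one
  have hfin : (Set.Ico (Q.val t) 1).Finite := by
    refine ((Q.finite_val_Ioc ht0 ht).insert (Q.val t)).subset fun γ hγ => ?_
    rcases hγ.1.eq_or_lt with h | h
    · exact Or.inl h.symm
    · exact Or.inr ⟨h, hγ.2.le⟩
  obtain ⟨γ, hγ, hmax⟩ := Set.exists_max_image _ id hfin ⟨_, le_rfl, ht⟩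
  obtain ⟨ϖ, rfl⟩ := Q.localRing.valuation_surjective γ
  have hϖ0 : ϖ ≠ 0 := by
    rintro rfl
    have := hγ.1
    rw [map_zero, le_zero_iff] at this
    exact Q.val_ne_zero ht0 this
  have hpos := Q.val_pos hϖ0
  have hmax' : ∀ f : C.FunctionField, Q.val ϖ < Q.val f → Q.val f ≤ 1 → Q.val f = 1 := by
    intro f h1 h2
    by_contra h3
    exact (hmax (Q.val f) ⟨hγ.1.trans h1.le, lt_of_le_of_ne h2 h3⟩).not_gt h1
  have key : ∀ f : C.FunctionField, f ≠ 0 → Q.val f ≤ 1 → ∃ n : ℕ, Q.val f = Q.val ϖ ^ n := by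
    intro f hf0 hf1
    rcases hf1.eq_or_lt with h1 | h1
    · exact ⟨0, by simpa using h1⟩
    have hex : ∃ n : ℕ, Q.val ϖ ^ n ≤ Q.val f := by
      by_contra! hall
      refine Set.infinite_of_injective_forall_mem (f := fun n : ℕ => Q.val ϖ ^ n)
        (pow_right_strictAnti₀ hpos hγ.2).injective
        (fun n => Set.mem_Ioc.mpr ⟨hall n, pow_le_one' hγ.2.le _⟩) (Q.finite_val_Ioc hf0 h1)
    classical
    obtain ⟨n, hn⟩ : ∃ n, Nat.find hex = n + 1 := by
      refine Nat.exists_eq_succ_of_ne_zero fun h0 => ?_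
      have := Nat.find_spec hex
      rw [h0, pow_zero] at this
      exact this.not_gt h1
    have hlow := Nat.find_spec hex
    rw [hn] at hlow
    have hhigh : Q.val f < Q.val ϖ ^ n := not_le.mp (Nat.find_min hex (by omega))
    refine ⟨n + 1, le_antisymm ?_ hlow⟩
    by_contra! hlt
    have hdiv : Q.val (f / ϖ ^ n) = 1 := by
      apply hmax'
      · rw [map_div₀, map_pow, lt_div_iff₀ (pow_pos hpos n), ← pow_succ']
        exact hlt
      · rw [map_div₀, map_pow]
        exact div_le_one_of_le₀ hhigh.le zero_le
    rw [map_div₀, map_pow, div_eq_one_iff_eq (pow_ne_zero _ hpos.ne')] at hdiv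
    exact hhigh.ne hdiv
  refine ⟨ϖ, hϖ0, hγ.2, fun f hf => ?_⟩
  rcases le_total (Q.val f) 1 with h | h
  · obtain ⟨n, hn⟩ := key f hf h
    exact ⟨n, by simpa using hn⟩
  · obtain ⟨n, hn⟩ := key f⁻¹ (inv_ne_zero hf) (by
      rw [map_inv₀]; exact inv_le_one_of_one_le₀ h)
    refine ⟨-n, ?_⟩
    rw [map_inv₀] at hn
    rw [zpow_neg, zpow_natCast, ← hn, inv_inv]

namespace IsUniformizer

variable {Q : C.Point} {ϖ : C.FunctionField} (h : Q.IsUniformizer ϖ)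
include h

theorem val_pos : 0 < Q.val ϖ := Q.val_pos h.ne_zero

theorem zpow_strictAnti : StrictAnti fun n : ℤ => Q.val ϖ ^ n :=
  zpow_right_strictAnti₀ h.val_pos h.lt_one

theorem zpow_inj {m n : ℤ} : Q.val ϖ ^ m = Q.val ϖ ^ n ↔ m = n :=
  h.zpow_strictAnti.injective.eq_iff

theorem zpow_le {m n : ℤ} : Q.val ϖ ^ m ≤ Q.val ϖ ^ n ↔ n ≤ m :=
  h.zpow_strictAnti.le_iff_ge

theorem exists_pow_of_le_one {f : C.FunctionField} (hf0 : f ≠ 0) (hf : Q.val f ≤ 1) :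
    ∃ n : ℕ, Q.val f = Q.val ϖ ^ n := by
  obtain ⟨n, hn⟩ := h.exists_zpow f hf0
  have : (0 : ℤ) ≤ n := by
    rw [← h.zpow_le, ← hn, zpow_zero]; exact hf
  lift n to ℕ using this
  exact ⟨n, by simpa using hn⟩

theorem val_le_of_lt_one {f : C.FunctionField} (hf : Q.val f < 1) : Q.val f ≤ Q.val ϖ := by
  by_cases hf0 : f = 0
  · simp [hf0]
  obtain ⟨n, hn⟩ := h.exists_pow_of_le_one hf0 hf.le
  rw [hn]
  have : n ≠ 0 := by rintro rfl; rw [hn, pow_zero] at hf; exact hf.ne rfl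
  exact pow_le_of_le_one zero_le h.lt_one.le this

theorem maximalIdeal_pow (n : ℕ) (x : Q.localRing) :
    x ∈ IsLocalRing.maximalIdeal Q.localRing ^ n ↔ Q.val x ≤ Q.val ϖ ^ n := by
  have hmem : ϖ ∈ Q.localRing := (Q.localRing.valuation_le_one_iff _).mp h.lt_one.le
  have dvd_iff : ∀ y z : Q.localRing, y ∣ z ↔ Q.val z ≤ Q.val y := by
    intro y z
    rw [Point.val, ValuationSubring.valuation_le_iff]
    constructor
    · rintro ⟨a, rfl⟩; exact ⟨a, by push_cast; ring⟩
    · rintro ⟨a, ha⟩; exact ⟨a, Subtype.ext (by rw [← ha]; push_cast; ring)⟩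
  have hspan : IsLocalRing.maximalIdeal Q.localRing = Ideal.span {⟨ϖ, hmem⟩} := by
    ext y
    rw [ValuationSubring.valuation_lt_one_iff, Ideal.mem_span_singleton, dvd_iff]
    exact ⟨fun hy => h.val_le_of_lt_one hy, fun hy => hy.trans_lt h.lt_one⟩
  rw [hspan, Ideal.span_singleton_pow, Ideal.mem_span_singleton, dvd_iff]
  simp

end IsUniformizer

theorem exists_pow_val_lt [IsAlgClosed k] (Q : C.Point) {x f : C.FunctionField} (hx : Q.val x < 1)
    (hf : f ≠ 0) : ∃ N : ℕ, Q.val x ^ N < Q.val f := by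
  obtain ⟨ϖ, h⟩ := Q.exists_isUniformizer
  obtain ⟨n, hn⟩ := h.exists_zpow f hf
  refine ⟨n.toNat + 1, (pow_le_pow_left' (h.val_le_of_lt_one hx) _).trans_lt ?_⟩
  rw [hn, ← zpow_natCast]
  exact h.zpow_strictAnti (by push_cast; omega)

end Point

/-! ### Ramification indices through valuations -/

namespace Cover

variable (f : Cover C D) (Q : C.Point)

theorem val_pullback_le_one {a : D.FunctionField} :
    Q.val (f.pullback a) ≤ 1 ↔ (f.onPoints Q).val a ≤ 1 := by
  rw [Point.val, Point.val, ValuationSubring.valuation_le_one_iff,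
    ValuationSubring.valuation_le_one_iff]
  exact Iff.rfl

theorem val_pullback_le {a b : D.FunctionField} :
    Q.val (f.pullback a) ≤ Q.val (f.pullback b) ↔ (f.onPoints Q).val a ≤ (f.onPoints Q).val b := by
  by_cases hb : b = 0
  · simp [hb]
  have hb' : f.pullback b ≠ 0 := by simpa using hb
  have := f.val_pullback_le_one Q (a := a / b)
  rwa [map_div₀, map_div₀, map_div₀, div_le_one₀ (Q.val_pos hb'),
    div_le_one₀ (Point.val_pos _ hb)] at this

theorem val_pullback_lt {a b : D.FunctionField} :
    Q.val (f.pullback a) < Q.val (f.pullback b) ↔ (f.onPoints Q).val a < (f.onPoints Q).val b := by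
  rw [← not_le, val_pullback_le, not_le]

theorem val_pullback_eq {a b : D.FunctionField} :
    Q.val (f.pullback a) = Q.val (f.pullback b) ↔ (f.onPoints Q).val a = (f.onPoints Q).val b := by
  rw [le_antisymm_iff, le_antisymm_iff, val_pullback_le, val_pullback_le]

theorem val_pullback_lt_one {a : D.FunctionField} :
    Q.val (f.pullback a) < 1 ↔ (f.onPoints Q).val a < 1 := by
  simpa using f.val_pullback_lt Q (a := a) (b := 1)

/-- Translates the ideal-theoretic index into the exponent relating two uniformizers; later
arguments about ramification use only this form. -/
theorem val_ramificationIndex [IsAlgClosed k] {π : D.FunctionField} {ϖ : C.FunctionField}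
    (hπ : (f.onPoints Q).IsUniformizer π) (hϖ : Q.IsUniformizer ϖ) :
    f.ramificationIndex Q ≠ 0 ∧ Q.val (f.pullback π) = Q.val ϖ ^ f.ramificationIndex Q := by
  have h1 : Q.val (f.pullback π) < 1 := (f.val_pullback_lt_one Q).mpr hπ.lt_one
  obtain ⟨n, hn⟩ := hϖ.exists_pow_of_le_one (f := f.pullback π) (by simpa using hπ.ne_zero) h1.le
  have hn0 : n ≠ 0 := by rintro rfl; rw [hn, pow_zero] at h1; exact h1.ne rfl
  suffices f.ramificationIndex Q = n by rw [this]; exact ⟨hn0, hn⟩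
  have hle : ∀ m : ℕ, (IsLocalRing.maximalIdeal (f.onPoints Q).localRing).map (f.localHom Q) ≤
      IsLocalRing.maximalIdeal Q.localRing ^ m ↔ m ≤ n := by
    intro m
    rw [Ideal.map_le_iff_le_comap]
    have hmono : Q.val (f.pullback π) ≤ Q.val ϖ ^ m ↔ m ≤ n := by
      rw [hn, ← zpow_natCast, ← zpow_natCast, hϖ.zpow_le]
      exact_mod_cast Iff.rfl
    rw [← hmono]
    constructor
    · intro h
      have hπm : π ∈ (f.onPoints Q).localRing :=
        (ValuationSubring.valuation_le_one_iff _ _).mp hπ.lt_one.le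
      have := h (show (⟨π, hπm⟩ : (f.onPoints Q).localRing) ∈ _ from
        (ValuationSubring.valuation_lt_one_iff _ _).mpr hπ.lt_one)
      rw [Ideal.mem_comap, hϖ.maximalIdeal_pow] at this
      exact this
    · intro h x hx
      rw [Ideal.mem_comap, hϖ.maximalIdeal_pow]
      rw [ValuationSubring.valuation_lt_one_iff] at hx
      exact ((f.val_pullback_le Q).mpr (hπ.val_le_of_lt_one hx)).trans h
  letI := (f.localHom Q).toAlgebra
  exact Ideal.ramificationIdx'_spec ((hle n).mpr le_rfl) fun h => by
    have := (hle (n + 1)).mp h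
    omega

theorem ramificationIndex_ne_zero [IsAlgClosed k] : f.ramificationIndex Q ≠ 0 := by
  obtain ⟨π, hπ⟩ := (f.onPoints Q).exists_isUniformizer
  obtain ⟨ϖ, hϖ⟩ := Q.exists_isUniformizer
  exact (f.val_ramificationIndex Q hπ hϖ).1

/-- Every cover of curves is surjective on points. -/
theorem onPoints_surjective : Function.Surjective f.onPoints := by
  intro P
  -- Chevalley's extension theorem: some valuation ring upstairs dominates the local ring of P.
  -- Locality of the map forces its contraction to be no larger than that ring.
  obtain ⟨A, hA, hloc⟩ := IsLocalRing.exists_factor_valuationRing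
    (f.pullback.toRingHom.comp P.localRing.subtype)
  have hcomap : A.comap f.pullback.toRingHom = P.localRing := by
    refine le_antisymm (fun x hx => ?_) fun x hx => hA ⟨x, hx⟩
    by_contra hxP
    have hx0 : x ≠ 0 := by rintro rfl; exact hxP (zero_mem _)
    have hinv : x⁻¹ ∈ P.localRing := (P.localRing.mem_or_inv_mem x).resolve_left hxP
    have hu : IsUnit (⟨x⁻¹, hinv⟩ : P.localRing) := by
      refine hloc.map_nonunit _ (IsUnit.of_mul_eq_one ⟨f.pullback x, hx⟩ (Subtype.ext ?_))
      change f.pullback x⁻¹ * f.pullback x = 1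
      rw [← map_mul, inv_mul_cancel₀ hx0, map_one]
    obtain ⟨y, hy⟩ := hu.exists_right_inv
    have hy' : x⁻¹ * (y : D.FunctionField) = 1 := congrArg Subtype.val hy
    apply hxP
    rw [show x = (y : D.FunctionField) from by field_simp at hy'; exact hy'.symm]
    exact y.2
  refine ⟨⟨A, fun c => ?_, fun htop => ?_⟩, Point.ext hcomap⟩
  · rw [← f.pullback.commutes c]
    exact hA ⟨_, P.algebraMap_mem c⟩
  · apply P.ne_top
    rw [← hcomap, htop]
    exact top_le_iff.mp fun x _ => ValuationSubring.mem_top _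

end Cover

/-- A non-constant function vanishes somewhere. -/
theorem exists_point_val_lt_one [IsAlgClosed k] {a : C.FunctionField}
    (ha : a ∉ (algebraMap k C.FunctionField).range) : ∃ Q : C.Point, Q.val a < 1 := by
  obtain ⟨Q, hQ⟩ :=
    (coverOfTranscendental a (transcendental_of_notMem_range ha)).onPoints_surjective
      (projectiveLine.affinePoint 0)
  have h0 : (projectiveLine.affinePoint (0 : k)).val projectiveLine.coord < 1 := by
    have h := Valuation.isEquiv_valuation_valuationSubring
      ((projectiveLine.primeAt (0 : k)).valuation (RatFunc k))
    refine (h.lt_one_iff_lt_one).mp ?_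
    rw [projectiveLine.coord, ← RatFunc.algebraMap_X,
      IsDedekindDomain.HeightOneSpectrum.valuation_lt_one_iff_mem]
    simp [projectiveLine.primeAt]
  refine ⟨Q, ?_⟩
  rw [← hQ, ← Cover.val_pullback_lt_one, coverOfTranscendental_coord] at h0
  exact h0

end SmoothCurve

/-! ### Unramified covers by extraction of roots -/

namespace SmoothCurve

variable {k : Type u} [Field k] {C D E : SmoothCurve k}

/-- The valuation of `g` at the point `Q` is divisible by `n` in the value group. -/
def Point.IsPow (Q : C.Point) (n : ℕ) (g : C.FunctionField) : Prop := ∃ h, Q.val g = Q.val h ^ n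

theorem Point.IsPow.pullback {f : Cover C D} {Q : C.Point} {n : ℕ} {g : D.FunctionField}
    (h : (f.onPoints Q).IsPow n g) : Q.IsPow n (f.pullback g) := by
  obtain ⟨a, ha⟩ := h
  refine ⟨f.pullback a, ?_⟩
  rw [← map_pow] at ha ⊢
  rw [← map_pow, f.val_pullback_eq]
  exact ha

namespace Cover

/-- The composition of two covers. -/
def comp (g : Cover D E) (f : Cover C D) : Cover C E := ⟨f.pullback.comp g.pullback⟩

/-- The identity cover. -/
def refl (C : SmoothCurve k) : Cover C C := ⟨AlgHom.id k _⟩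

/-- A separable cover which does not enlarge the value groups at the points. -/
def IsImmediate (f : Cover C D) : Prop :=
  (letI := f.extension
   Algebra.IsSeparable D.FunctionField C.FunctionField) ∧
  ∀ (Q : C.Point) (x : C.FunctionField), ∃ a : D.FunctionField, Q.val x = Q.val (f.pullback a)

theorem isImmediate_refl (C : SmoothCurve k) : (refl C).IsImmediate := by
  refine ⟨?_, fun Q x => ⟨x, rfl⟩⟩
  exact inferInstanceAs (Algebra.IsSeparable C.FunctionField C.FunctionField)

theorem IsImmediate.comp {g : Cover D E} {f : Cover C D} (hg : g.IsImmediate)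
    (hf : f.IsImmediate) : (g.comp f).IsImmediate := by
  refine ⟨?_, fun Q x => ?_⟩
  · letI := g.extension
    letI := f.extension
    letI := (g.comp f).extension
    haveI : IsScalarTower E.FunctionField D.FunctionField C.FunctionField :=
      IsScalarTower.of_algebraMap_eq fun _ => rfl
    haveI := hg.1
    haveI := hf.1
    exact Algebra.IsSeparable.trans E.FunctionField D.FunctionField C.FunctionField
  · obtain ⟨a, ha⟩ := hf.2 Q x
    obtain ⟨b, hb⟩ := hg.2 (f.onPoints Q) a
    exact ⟨b, ha.trans ((f.val_pullback_eq Q).mpr hb)⟩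

/-- A uniformizer upstairs has the value of a function from below, which is at most that of a
uniformizer below; so the index cannot exceed 1. -/
theorem IsImmediate.isUnramified [IsAlgClosed k] {f : Cover C D} (hf : f.IsImmediate) :
    f.IsUnramified := by
  refine ⟨hf.1, fun Q => ?_⟩
  obtain ⟨π, hπ⟩ := (f.onPoints Q).exists_isUniformizer
  obtain ⟨ϖ, hϖ⟩ := Q.exists_isUniformizer
  obtain ⟨he0, he⟩ := f.val_ramificationIndex Q hπ hϖ
  obtain ⟨a, ha⟩ := hf.2 Q ϖ
  have h1 : (f.onPoints Q).val a < 1 := by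
    rw [← f.val_pullback_lt_one, ← ha]; exact hϖ.lt_one
  have h2 := (f.val_pullback_le Q).mpr (hπ.val_le_of_lt_one h1)
  rw [← ha, he] at h2
  have h3 : f.ramificationIndex Q ≤ 1 := by
    have := (hϖ.zpow_le (m := 1) (n := f.ramificationIndex Q)).mp (by simpa using h2)
    exact_mod_cast this
  omega

end Cover

/-- The functions in the closure of the image of a cover, for the valuation at a point. -/
def Cover.IsLimit (f : Cover C D) (Q : C.Point) (x : C.FunctionField) : Prop :=
  ∀ y : C.FunctionField, y ≠ 0 → ∃ a : D.FunctionField, Q.val (x - f.pullback a) < Q.val y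

namespace Cover.IsLimit

variable {f : Cover C D} {Q : C.Point} {x y : C.FunctionField}

theorem of_pullback (a : D.FunctionField) : f.IsLimit Q (f.pullback a) := fun y hy =>
  ⟨a, by simpa using Q.val_pos hy⟩

/-- An approximation of x with error smaller than x itself has the value of x. This turns density of
the base field into equality of value groups. -/
theorem exists_val_eq (h : f.IsLimit Q x) : ∃ a : D.FunctionField, Q.val x = Q.val (f.pullback a) := by
  by_cases hx : x = 0
  · exact ⟨0, by simp [hx]⟩
  obtain ⟨a, ha⟩ := h x hx
  refine ⟨a, ?_⟩
  have := Valuation.map_sub_eq_of_lt_right _ ha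
  rw [sub_sub_cancel_left, Valuation.map_neg] at this
  exact this.symm

theorem add (hx : f.IsLimit Q x) (hy : f.IsLimit Q y) : f.IsLimit Q (x + y) := by
  intro z hz
  obtain ⟨a, ha⟩ := hx z hz
  obtain ⟨b, hb⟩ := hy z hz
  refine ⟨a + b, ?_⟩
  rw [map_add, add_sub_add_comm]
  exact Valuation.map_add_lt _ ha hb

theorem mul (hx : f.IsLimit Q x) (hy : f.IsLimit Q y) : f.IsLimit Q (x * y) := by
  by_cases hx0 : x = 0
  · simpa [hx0] using of_pullback (f := f) (Q := Q) 0
  intro z hz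
  obtain ⟨b, hb⟩ := hy (z / x) (div_ne_zero hz hx0)
  have hb' : Q.val (x * (y - f.pullback b)) < Q.val z := by
    rw [map_mul]
    rw [map_div₀, lt_div_iff₀' (Q.val_pos hx0)] at hb
    exact hb
  by_cases hb0 : f.pullback b = 0
  · exact ⟨0, by simpa [hb0] using hb'⟩
  obtain ⟨a, ha⟩ := hx (z / f.pullback b) (div_ne_zero hz hb0)
  have ha' : Q.val ((x - f.pullback a) * f.pullback b) < Q.val z := by
    rw [map_mul]
    rw [map_div₀, lt_div_iff₀ (Q.val_pos hb0)] at ha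
    exact ha
  refine ⟨a * b, ?_⟩
  have := Valuation.map_add_lt _ hb' ha'
  rwa [show x * (y - f.pullback b) + (x - f.pullback a) * f.pullback b =
    x * y - f.pullback (a * b) by rw [map_mul]; ring] at this

theorem eval₂ (hx : f.IsLimit Q x) (p : D.FunctionField[X]) :
    f.IsLimit Q (p.eval₂ f.pullback.toRingHom x) := by
  induction p using Polynomial.induction_on' with
  | add p q hp hq => rw [eval₂_add]; exact hp.add hq
  | monomial n a =>
    rw [eval₂_monomial]
    refine (of_pullback a).mul ?_
    induction n with
    | zero => simpa using of_pullback (f := f) (Q := Q) 1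
    | succ n ih => rw [pow_succ]; exact ih.mul hx

/-- An `n`-th root is a limit of functions from the base if the valuation of the radicand is
divisible by `n`. -/
theorem of_pow_eq [IsAlgClosed k] {n : ℕ} (hn : (n : k) ≠ 0) {s : C.FunctionField}
    {g : D.FunctionField} (hg0 : g ≠ 0) (hs : s ^ n = f.pullback g)
    (hg : (f.onPoints Q).IsPow n g) : f.IsLimit Q s := by
  have hn0 : n ≠ 0 := by rintro rfl; simp at hn
  obtain ⟨h, hh⟩ := hg
  have hh0 : h ≠ 0 := by
    rintro rfl
    rw [map_zero, zero_pow hn0] at hh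
    exact Point.val_ne_zero _ hg0 hh
  have hfh0 : f.pullback h ≠ 0 := by simpa using hh0
  -- Dividing by h makes the root a unit, while its n-th power still comes from the base. Its
  -- residue c starts a Newton iteration.
  set r := s / f.pullback h with hr
  set v := g / h ^ n with hv
  have hrn : r ^ n = f.pullback v := by rw [hr, hv, div_pow, hs, map_div₀, map_pow]
  have hr1 : Q.val r = 1 := by
    have h1 : Q.val r ^ n = 1 := by
      rw [← map_pow, hrn, ← map_one Q.val, ← map_one f.pullback, f.val_pullback_eq, hv, map_div₀,
        map_pow, hh, map_one, div_self (pow_ne_zero _ (Point.val_ne_zero _ hh0))]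
    exact (pow_left_inj₀ zero_le zero_le hn0).mp (by rwa [one_pow])
  obtain ⟨c, hc⟩ := Q.exists_val_sub_lt_one hr1.le
  have key : ∀ N : ℕ, ∃ a : D.FunctionField,
      Q.val (r - f.pullback a) ≤ Q.val (r - algebraMap k _ c) ^ (N + 1) := by
    intro N
    induction N with
    | zero => exact ⟨algebraMap k _ c, by simp⟩
    | succ N ih =>
      obtain ⟨a, ha⟩ := ih
      have hlt : Q.val (r - f.pullback a) < 1 :=
        ha.trans_lt (pow_lt_one₀ zero_le hc (by omega))
      have ha1 : Q.val (f.pullback a) = 1 := by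
        have := Valuation.map_sub_eq_of_lt_left (Q.val) (x := r) (y := r - f.pullback a)
          (by rwa [hr1])
        rwa [sub_sub_cancel, hr1] at this
      have hle : Q.val (r - f.pullback a) ≤ Q.val (r - algebraMap k _ c) :=
        ha.trans (pow_le_of_le_one zero_le hc.le (by omega))
      let α : Q.localRing := ⟨f.pullback a, (Q.localRing.valuation_le_one_iff _).mp ha1.le⟩
      let δ : Q.localRing := ⟨r - f.pullback a, (Q.localRing.valuation_le_one_iff _).mp hlt.le⟩
      obtain ⟨R, hR⟩ := powAddExpansion α δ n
      have hR' := congrArg Subtype.val hR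
      push_cast at hR'
      have e1 : (α : C.FunctionField) + δ = r := by simp [α, δ]
      rw [e1] at hR'
      have hnv : Q.val (n * f.pullback a ^ (n - 1)) = 1 := by
        rw [map_mul, map_pow, ha1, one_pow, mul_one,
          show (n : C.FunctionField) = algebraMap k _ (n : k) by simp, Q.val_algebraMap hn]
      have hnv0 : (n * f.pullback a ^ (n - 1) : C.FunctionField) ≠ 0 := by
        intro h0; rw [h0, map_zero] at hnv; exact zero_ne_one hnv
      -- Newton's step for X ^ n - v. The derivative is a unit because n is invertible in k, so the
      -- new error is a regular multiple of the square of the old one.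
      refine ⟨a - (a ^ n - v) / (n * a ^ (n - 1)), ?_⟩
      have e2 : r - f.pullback (a - (a ^ n - v) / (n * a ^ (n - 1))) =
          -((R : C.FunctionField) * (r - f.pullback a) ^ 2) / (n * f.pullback a ^ (n - 1)) := by
        rw [map_sub, map_div₀, map_sub, map_mul, map_pow, map_pow, map_natCast, ← hrn, hR']
        change r - (f.pullback a - (f.pullback a ^ n - (f.pullback a ^ n +
          n * f.pullback a ^ (n - 1) * (r - f.pullback a) + R * (r - f.pullback a) ^ 2)) /
          (n * f.pullback a ^ (n - 1))) = _
        rw [eq_div_iff hnv0, sub_mul, sub_mul, div_mul_cancel₀ _ hnv0]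
        ring
      rw [e2, map_div₀, hnv, div_one, Valuation.map_neg, map_mul, map_pow, sq, pow_succ]
      calc _ ≤ 1 * (Q.val (r - f.pullback a) * Q.val (r - f.pullback a)) :=
            mul_le_mul_left (Q.localRing.valuation_le_one R) _
        _ ≤ _ := by rw [one_mul]; exact mul_le_mul' ha hle
  have hrlim : f.IsLimit Q r := by
    intro y hy
    obtain ⟨N, hN⟩ := Q.exists_pow_val_lt hc hy
    obtain ⟨a, ha⟩ := key N
    refine ⟨a, ha.trans_lt (lt_of_le_of_lt ?_ hN)⟩
    rw [pow_succ]
    exact mul_le_of_le_one_right' hc.le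
  have : s = r * f.pullback h := by rw [hr, div_mul_cancel₀ _ hfh0]
  rw [this]
  exact hrlim.mul (of_pullback h)

end Cover.IsLimit

/-- The curve whose function field is a given finite extension of the function field of `C`. -/
def ofFiniteExtension (C : SmoothCurve k) (L : Type u) [Field L] [Algebra k L]
    [Algebra C.FunctionField L] [IsScalarTower k C.FunctionField L]
    [Module.Finite C.FunctionField L] : SmoothCurve k where
  FunctionField := L
  essFiniteType := Algebra.EssFiniteType.comp k C.FunctionField L
  trdeg_eq_one := by
    have h' := trdeg_add_eq k C.FunctionField (A := L)
    rw [C.trdeg_eq_one, trdeg_eq_zero, add_zero] at h'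
    exact h'.symm

/-- The cover defined by a finite extension of the function field. -/
def ofFiniteExtensionCover (C : SmoothCurve k) (L : Type u) [Field L] [Algebra k L]
    [Algebra C.FunctionField L] [IsScalarTower k C.FunctionField L]
    [Module.Finite C.FunctionField L] : Cover (C.ofFiniteExtension L) C where
  pullback := IsScalarTower.toAlgHom k C.FunctionField L

theorem isSeparable_ofFiniteExtensionCover (C : SmoothCurve k) (L : Type u) [Field L] [Algebra k L]
    [Algebra C.FunctionField L] [IsScalarTower k C.FunctionField L]
    [Module.Finite C.FunctionField L] [Algebra.IsSeparable C.FunctionField L] :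
    letI := (C.ofFiniteExtensionCover L).extension
    Algebra.IsSeparable C.FunctionField (C.ofFiniteExtension L).FunctionField := by
  have he : (C.ofFiniteExtensionCover L).extension =
      (inferInstance : Algebra C.FunctionField L) := Algebra.algebra_ext _ _ fun _ => rfl
  change @Algebra.IsSeparable C.FunctionField L _ _ (C.ofFiniteExtensionCover L).extension
  rw [he]
  infer_instance

/-- If all valuations of `g` are divisible by the prime `p`, which is invertible in `k`, then `g`
becomes a `p`-th power on an unramified cover. -/
theorem exists_isImmediate_pow_eq [IsAlgClosed k] {p : ℕ} (hp : p.Prime) (hpk : (p : k) ≠ 0)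
    {g : C.FunctionField} (hg0 : g ≠ 0) (hg : ∀ Q : C.Point, Q.IsPow p g) :
    ∃ (C' : SmoothCurve k) (τ : Cover C' C), τ.IsImmediate ∧
      ∃ s : C'.FunctionField, s ^ p = τ.pullback g := by
  by_cases hpow : ∃ b, b ^ p = g
  · obtain ⟨b, hb⟩ := hpow
    exact ⟨C, Cover.refl C, Cover.isImmediate_refl C, b, hb⟩
  push Not at hpow
  have hirr := X_pow_sub_C_irreducible_of_prime hp hpow
  haveI : Fact (Irreducible (X ^ p - Polynomial.C g)) := ⟨hirr⟩
  haveI : Module.Finite C.FunctionField (AdjoinRoot (X ^ p - Polynomial.C g)) :=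
    (AdjoinRoot.powerBasis hirr.ne_zero).finite
  have hroot : (AdjoinRoot.root (X ^ p - Polynomial.C g)) ^ p = AdjoinRoot.of _ g := by
    have := AdjoinRoot.eval₂_root (X ^ p - Polynomial.C g)
    rwa [eval₂_sub, eval₂_pow, eval₂_X, eval₂_C, sub_eq_zero] at this
  refine ⟨C.ofFiniteExtension (AdjoinRoot (X ^ p - Polynomial.C g)),
    C.ofFiniteExtensionCover _, ⟨?_, fun Q x => ?_⟩, AdjoinRoot.root _, hroot⟩
  · have hsep : (X ^ p - Polynomial.C g).Separable := by
      refine separable_X_pow_sub_C g (fun h => hpk ?_) hg0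
      rw [← map_natCast (algebraMap k C.FunctionField)] at h
      exact (map_eq_zero _).mp h
    have hs : IsSeparable C.FunctionField (AdjoinRoot.root (X ^ p - Polynomial.C g)) := by
      refine hsep.of_dvd (minpoly.dvd _ _ ?_)
      rw [aeval_def]
      exact AdjoinRoot.eval₂_root _
    rw [← IntermediateField.isSeparable_adjoin_simple_iff_isSeparable,
      IntermediateField.adjoin_root_eq_top] at hs
    have := AlgEquiv.Algebra.isSeparable
      (IntermediateField.topEquiv (F := C.FunctionField) (E := AdjoinRoot (X ^ p - Polynomial.C g)))
    exact C.isSeparable_ofFiniteExtensionCover _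
  -- Every element is a polynomial in the root, and limits are closed under polynomial expressions
  -- over the base.
  · obtain ⟨q, rfl⟩ := AdjoinRoot.mk_surjective x
    have hlim := Cover.IsLimit.of_pow_eq
      (f := C.ofFiniteExtensionCover (AdjoinRoot (X ^ p - Polynomial.C g))) (Q := Q) hpk hg0 hroot
      (hg _)
    obtain ⟨a, ha⟩ := (hlim.eval₂ q).exists_val_eq
    exact ⟨a, (congrArg Q.val (AdjoinRoot.aeval_eq q)).symm.trans ha⟩

end SmoothCurve

/-! ### Local computations for y² + (l w + 1) y + w³ = 0 and for w (3 t - l) = t³ + 1 -/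

section Valuation

variable {F Γ : Type*} [Field F] [LinearOrderedCommGroupWithZero Γ] (v : Valuation F Γ)

theorem Valuation.le_one_of_monic_quadratic {l W Y : F} (hl : v l ≤ 1)
    (h : Y ^ 2 + (l * W + 1) * Y + W ^ 3 = 0) (hW : v W ≤ 1) : v Y ≤ 1 := by
  by_contra! hY
  have h1 : v ((l * W + 1) * Y + W ^ 3) ≤ v Y := by
    refine Valuation.map_add_le _ ?_ ?_
    · rw [map_mul]
      refine mul_le_of_le_one_left' (Valuation.map_add_le _ ?_ (by simp))
      rw [map_mul]; exact mul_le_one' hl hW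
    · rw [map_pow]; exact (pow_le_one' hW 3).trans hY.le
  rw [show (l * W + 1) * Y + W ^ 3 = -(Y ^ 2) by linear_combination h, Valuation.map_neg, map_pow,
    sq] at h1
  exact h1.not_gt (lt_mul_of_one_lt_left (zero_lt_one.trans hY) hY)

/-- At a pole of W, the pole of Y must be strictly larger, so the middle term is dominated by Y² and
the equation balances Y² against W³. -/
theorem Valuation.sq_eq_cube_of_pole {l W Y : F} (hl : v l ≤ 1)
    (h : Y ^ 2 + (l * W + 1) * Y + W ^ 3 = 0) (hW : 1 < v W) : v Y ^ 2 = v W ^ 3 := by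
  have hW0 : 0 < v W := zero_lt_one.trans hW
  have hlW : v (l * W + 1) ≤ v W := by
    refine Valuation.map_add_le _ ?_ (by simpa using hW.le)
    rw [map_mul]; exact mul_le_of_le_one_left' hl
  have hYW : v W < v Y := by
    by_contra! hle
    have h1 : v (Y ^ 2 + (l * W + 1) * Y) ≤ v W ^ 2 := by
      refine Valuation.map_add_le _ ?_ ?_
      · rw [map_pow]; exact pow_le_pow_left' hle 2
      · rw [map_mul, sq]; exact mul_le_mul' hlW hle
    rw [show Y ^ 2 + (l * W + 1) * Y = -(W ^ 3) by linear_combination h, Valuation.map_neg,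
      map_pow] at h1
    exact h1.not_gt (pow_lt_pow_right₀ hW (by norm_num))
  have h2 : v ((l * W + 1) * Y) < v (Y ^ 2) := by
    rw [map_mul, map_pow, sq]
    exact mul_lt_mul_of_pos_right (hlW.trans_lt hYW) (hW0.trans hYW)
  have h3 := Valuation.map_add_eq_of_lt_left _ h2
  rw [show Y ^ 2 + (l * W + 1) * Y = -(W ^ 3) by linear_combination h, Valuation.map_neg, map_pow,
    map_pow] at h3
  exact h3.symm

/-- Where W is regular, Y (Y + l W + 1) = -W³ and the two factors cannot both vanish: W would vanish
too, while they differ by l W + 1. At a pole, Y² and W³ have equal value, so Y has the value of (Y /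
W)³. -/
theorem Valuation.exists_eq_cube {l W Y : F} (hl : v l ≤ 1)
    (h : Y ^ 2 + (l * W + 1) * Y + W ^ 3 = 0) : ∃ a, v Y = v a ^ 3 := by
  rcases lt_or_ge 1 (v W) with hW | hW
  · have h1 := v.sq_eq_cube_of_pole hl h hW
    have hW0 : v W ≠ 0 := (zero_lt_one.trans hW).ne'
    have hY0 : v Y ≠ 0 := by
      intro h0; rw [h0] at h1; exact pow_ne_zero 3 hW0 (by simpa using h1.symm)
    refine ⟨Y / W, ?_⟩
    rw [map_div₀, div_pow, ← h1, pow_succ, mul_div_cancel_left₀ _ (pow_ne_zero 2 hY0)]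
  · have hY := v.le_one_of_monic_quadratic hl h hW
    have hZ : v (Y + (l * W + 1)) ≤ 1 := by
      refine Valuation.map_add_le _ hY (Valuation.map_add_le _ ?_ (by simp))
      rw [map_mul]; exact mul_le_one' hl hW
    have hYZ : v Y * v (Y + (l * W + 1)) = v W ^ 3 := by
      rw [← map_mul, ← map_pow, ← Valuation.map_neg v (W ^ 3)]
      congr 1; linear_combination h
    rcases hY.eq_or_lt with hY1 | hY1
    · exact ⟨1, by simpa using hY1⟩
    rcases hZ.eq_or_lt with hZ1 | hZ1
    · exact ⟨W, by rw [← hYZ, hZ1, mul_one]⟩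
    · exfalso
      have hW1 : v W < 1 := by
        have : v W ^ 3 < 1 := by rw [← hYZ]; exact mul_lt_one' hY1 hZ1
        by_contra! hge
        exact this.not_ge (one_le_pow₀ hge)
      have h1 : v (l * W) < 1 := by
        rw [map_mul]; exact (mul_le_of_le_one_left' hl).trans_lt hW1
      have := Valuation.map_sub_lt v (Valuation.map_sub_lt v hZ1 hY1) h1
      rw [show Y + (l * W + 1) - Y - l * W = 1 by ring, map_one] at this
      exact this.ne rfl

section

variable {l W t : F} (h3 : v 3 = 1) (hl : v l ≤ 1) (hl3 : v (l ^ 3 + 27) = 1)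
  (h : W * (3 * t - l) = t ^ 3 + 1)
include h3 hl

theorem Valuation.map_three_mul_sub (ht : 1 < v t) : v (3 * t - l) = v t := by
  rw [Valuation.map_sub_eq_of_lt_left _ (by rw [map_mul, h3, one_mul]; exact hl.trans_lt ht),
    map_mul, h3, one_mul]

theorem Valuation.le_one_of_three_mul_sub (hs : v (3 * t - l) ≤ 1) : v t ≤ 1 := by
  by_contra! ht
  rw [v.map_three_mul_sub h3 hl ht] at hs
  exact hs.not_gt ht

include h in
theorem Valuation.eq_sq_of_pole (ht : 1 < v t) : v W = v t ^ 2 := by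
  have ht0 : v t ≠ 0 := (zero_lt_one.trans ht).ne'
  have h1 := congrArg v h
  rw [map_mul, v.map_three_mul_sub h3 hl ht, Valuation.map_add_eq_of_lt_left _
    (by rw [map_one, map_pow]; exact one_lt_pow₀ ht (by norm_num)), map_pow, pow_succ] at h1
  exact mul_right_cancel₀ ht0 h1

include hl3 in
-- Modulo 3 t - l, the function 27 (t³ + 1) is the unit l³ + 27: the value l/3 differs from the
-- roots of t³ + 1.
theorem Valuation.cube_add_one_eq_one (hs : v (3 * t - l) < 1) : v (t ^ 3 + 1) = 1 := by
  have ht := v.le_one_of_three_mul_sub h3 hl hs.le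
  have h1 : v ((3 * t - l) * ((3 * t) ^ 2 + 3 * t * l + l ^ 2)) < 1 := by
    rw [map_mul]
    refine (mul_le_of_le_one_right' ?_).trans_lt hs
    refine Valuation.map_add_le _ (Valuation.map_add_le _ ?_ ?_) ?_
    · rw [map_pow, map_mul, h3, one_mul]; exact pow_le_one' ht 2
    · rw [map_mul, map_mul, h3, one_mul]; exact mul_le_one' ht hl
    · rw [map_pow]; exact pow_le_one' hl 2
  have h2 := Valuation.map_add_eq_of_lt_left v (x := l ^ 3 + 27)
    (y := (3 * t - l) * ((3 * t) ^ 2 + 3 * t * l + l ^ 2)) (by rwa [hl3])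
  rw [hl3, show l ^ 3 + 27 + (3 * t - l) * ((3 * t) ^ 2 + 3 * t * l + l ^ 2) =
    3 ^ 3 * (t ^ 3 + 1) by ring, map_mul, map_pow, h3, one_pow, one_mul] at h2
  exact h2

include hl3 h in
theorem Valuation.mul_eq_one_of_zero (hs : v (3 * t - l) < 1) : v W * v (3 * t - l) = 1 := by
  rw [← map_mul, h, v.cube_add_one_eq_one h3 hl hl3 hs]

include hl3 h in
-- The roots of t³ + 1 are simple because 3 is a unit, and 3 t - l does not vanish at them. Hence W
-- has exactly the order of the vanishing factor.
theorem Valuation.eq_of_cube_root_of_neg_one {z : F} (hz : z ^ 3 = 1) (hs : v (t + z) < 1) :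
    v W = v (t + z) := by
  have hz1 : v z = 1 := by
    have : v z ^ 3 = 1 := by rw [← map_pow, hz, map_one]
    exact (pow_left_inj₀ zero_le zero_le (by norm_num : (3 : ℕ) ≠ 0)).mp (by rwa [one_pow])
  have ht : v t ≤ 1 := by
    rw [show t = (t + z) - z by ring]
    exact (Valuation.map_sub _ _ _).trans (max_le hs.le hz1.le)
  have e : t ^ 3 + 1 = (t + z) * (t ^ 2 - t * z + z ^ 2) := by linear_combination -hz
  have h2z : v (t - 2 * z) ≤ 1 := by
    refine (Valuation.map_sub _ _ _).trans (max_le ht ?_)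
    rw [two_mul]
    exact Valuation.map_add_le _ hz1.le hz1.le
  have hu : v (t ^ 2 - t * z + z ^ 2) = 1 := by
    rw [show t ^ 2 - t * z + z ^ 2 = 3 * z ^ 2 + (t + z) * (t - 2 * z) by ring]
    have h1 : v (3 * z ^ 2) = 1 := by rw [map_mul, map_pow, h3, hz1, one_pow, one_mul]
    rw [Valuation.map_add_eq_of_lt_left, h1]
    rw [h1, map_mul]
    exact (mul_le_of_le_one_right' h2z).trans_lt hs
  have hval : v (t ^ 3 + 1) = v (t + z) := by rw [e, map_mul, hu, mul_one]
  have hle : v (3 * t - l) ≤ 1 := by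
    refine (Valuation.map_sub _ _ _).trans (max_le ?_ hl)
    rw [map_mul, h3, one_mul]; exact ht
  rcases hle.eq_or_lt with h1 | h1
  · rw [← hval, ← h, map_mul, h1, mul_one]
  · have := v.cube_add_one_eq_one h3 hl hl3 h1
    rw [hval] at this
    exact absurd this hs.ne

end

end Valuation

/-! ### The tripling as a composition of two maps of degree three -/

namespace SmoothCurve

variable {k : Type u} [Field k] {C : SmoothCurve k}

theorem Point.val_ofNat (Q : C.Point) {n : ℕ} [n.AtLeastTwo] (hn : (OfNat.ofNat n : k) ≠ 0) :
    Q.val (OfNat.ofNat n : C.FunctionField) = 1 := by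
  rw [← map_ofNat (algebraMap k C.FunctionField) n, Q.val_algebraMap hn]

/-- From a point of `y² + (l w + 1) y + w³ = 0` to a point of a Hesse cubic, by an unramified
extraction of a cube root. -/
theorem exists_hesse_of_tripling [IsAlgClosed k] (h3 : (3 : k) ≠ 0) {l : k} {W Y : C.FunctionField}
    (hW0 : W ≠ 0) (h : Y ^ 2 + (algebraMap k _ l * W + 1) * Y + W ^ 3 = 0) :
    ∃ (C' : SmoothCurve k) (τ : Cover C' C) (x y : C'.FunctionField), τ.IsImmediate ∧
      x ^ 3 + y ^ 3 + 1 + algebraMap k _ l * x * y = 0 ∧ x * y = τ.pullback W := by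
  have hY0 : Y ≠ 0 := by
    rintro rfl
    exact hW0 (by simpa using h)
  obtain ⟨C', τ, hτ, s, hs⟩ := exists_isImmediate_pow_eq (k := k) Nat.prime_three
    (by exact_mod_cast h3) hY0 fun Q => Q.val.exists_eq_cube (Q.val_algebraMap_le_one l) h
  have hs0 : s ≠ 0 := by
    rintro rfl
    have : τ.pullback Y = 0 := by simpa using hs.symm
    exact hY0 (by simpa using this)
  have h' := congrArg τ.pullback h
  simp only [map_add, map_mul, map_pow, map_one, map_zero, AlgHom.commutes, ← hs] at h'
  -- With x³ = Y and x y = W one has y³ = W³ / Y, and the Hesse equation is the given one divided by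
  -- Y.
  refine ⟨C', τ, s, τ.pullback W / s, hτ, ?_, by field_simp⟩
  field_simp
  linear_combination h'

/-- The isomorphism between a Hesse cubic and a curve `y² + (l' w + 1) y + w³ = 0`. -/
theorem hesse_to_tripling {F : Type*} [Field F] {l μ ζ x y : F} (hμ0 : μ ≠ 0)
    (hμ : μ ^ 3 = l ^ 3 + 27) (hζ : ζ ^ 2 + ζ + 1 = 0)
    (h : x ^ 3 + y ^ 3 + 1 + l * x * y = 0) :
    ∃ W Y : F, 3 * (x + y) - l ≠ 0 ∧ W * (3 * (x + y) - l) = -μ ∧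
      Y * (3 * (x + y) - l) = ζ ^ 2 * (3 * x - ζ * l + 3 * ζ ^ 2 * y) ∧
      Y ^ 2 + (-3 * l / μ * W + 1) * Y + W ^ 3 = 0 := by
  have hζ3 : ζ ^ 3 = 1 := by linear_combination (ζ - 1) * hζ
  -- This is the factorisation of a³ + b³ + c³ - 3 a b c at a = 3x, b = -l, c = 3y. The three
  -- factors are the tangent lines at the flexes on the line at infinity, so their product is
  -- constant on the affine curve.
  have hprod : (3 * (x + y) - l) * ((3 * x - ζ * l + 3 * ζ ^ 2 * y) *
      (3 * x - ζ ^ 2 * l + 3 * ζ * y)) = -μ ^ 3 := by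
    have key : ∀ a b c : F, (a + ζ * b + ζ ^ 2 * c) * (a + ζ ^ 2 * b + ζ * c) =
        a ^ 2 + b ^ 2 + c ^ 2 - a * b - b * c - c * a := fun a b c => by
      linear_combination (a * b + a * c + b * c) * hζ + (b ^ 2 + c ^ 2 + b * c * ζ) * hζ3
    have h2 := key (3 * x) (-l) (3 * y)
    linear_combination (3 * (x + y) - l) * h2 + 27 * h + hμ
  have hX : 3 * (x + y) - l ≠ 0 := by
    intro h0
    rw [h0, zero_mul] at hprod
    exact pow_ne_zero 3 hμ0 (by linear_combination hprod)
  -- Weighted by 1, ζ², ζ, the three tangents sum to a constant. After division by the first one,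
  -- the product and the sum become the cubic and linear terms of the equation for W and Y.
  have hsum : (3 * (x + y) - l) + ζ ^ 2 * (3 * x - ζ * l + 3 * ζ ^ 2 * y) +
      ζ * (3 * x - ζ ^ 2 * l + 3 * ζ * y) = -3 * l := by
    linear_combination (3 * x + 3 * y) * hζ + (3 * y * ζ - 2 * l) * hζ3
  refine ⟨-μ / (3 * (x + y) - l), ζ ^ 2 * (3 * x - ζ * l + 3 * ζ ^ 2 * y) / (3 * (x + y) - l), hX,
    by field_simp, by field_simp, ?_⟩
  generalize 3 * (x + y) - l = X at *
  generalize 3 * x - ζ * l + 3 * ζ ^ 2 * y = B at *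
  generalize 3 * x - ζ ^ 2 * l + 3 * ζ * y = B' at *
  have e : (ζ ^ 2 * B / X) ^ 2 + (-3 * l / μ * (-μ / X) + 1) * (ζ ^ 2 * B / X) + (-μ / X) ^ 3 =
      (X * (ζ ^ 2 * B) * (ζ ^ 2 * B + 3 * l + X) - μ ^ 3) / X ^ 3 := by
    field_simp
    ring
  rw [e, div_eq_zero_iff]
  left
  linear_combination X * ζ ^ 2 * B * hsum - hprod - X * B * B' * hζ3

/-- One half of the tripling on the curve `y² + (l w + 1) y + w³ = 0`. -/
theorem exists_half_tripling [IsAlgClosed k] (h3 : (3 : k) ≠ 0) {ζ l l' μ : k}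
    (hζ : ζ ^ 2 + ζ + 1 = 0) (hμ0 : μ ≠ 0) (hμ : μ ^ 3 = l ^ 3 + 27) (hl' : l' = -3 * l / μ)
    {W Y : C.FunctionField} (hW0 : W ≠ 0)
    (h : Y ^ 2 + (algebraMap k _ l * W + 1) * Y + W ^ 3 = 0) :
    ∃ (C' : SmoothCurve k) (τ : Cover C' C) (t W' Y' : C'.FunctionField), τ.IsImmediate ∧
      τ.pullback W * (3 * t - algebraMap k _ l) = t ^ 3 + 1 ∧
      W' * (3 * t - algebraMap k _ l) = -algebraMap k _ μ ∧
      Y' ^ 2 + (algebraMap k _ l' * W' + 1) * Y' + W' ^ 3 = 0 := by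
  obtain ⟨C', τ, x, y, hτ, hxy, hW⟩ := exists_hesse_of_tripling h3 hW0 h
  obtain ⟨W', Y', -, hW', -, hY'⟩ := hesse_to_tripling (l := algebraMap k C'.FunctionField l)
    (μ := algebraMap k _ μ) (ζ := algebraMap k _ ζ) (by simpa using hμ0)
    (by rw [← map_pow, hμ, map_add, map_pow, map_ofNat]) (by rw [← map_pow, ← map_add, ← map_one (algebraMap k _),
      ← map_add, hζ, map_zero]) hxy
  -- Substituting x³ + y³ = t³ - 3 t x y and x y = W into the Hesse equation gives the relation
  -- between W and t = x + y.
  refine ⟨C', τ, x + y, W', Y', hτ, ?_, hW', ?_⟩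
  · rw [← hW]
    linear_combination -hxy
  · rw [hl', map_div₀, map_mul, map_neg, map_ofNat]
    exact hY'

/-- A constant t would make W constant unless 3 t = l; but then t³ = -1, against l³ ≠ -27. -/
theorem notMem_range_of_mul_eq {F : Type*} [Field F] [Algebra k F] {l : k} {W t : F}
    (hl : l ^ 3 + 27 ≠ 0) (hW : W ∉ (algebraMap k F).range)
    (h : W * (3 * t - algebraMap k _ l) = t ^ 3 + 1) : t ∉ (algebraMap k F).range := by
  rintro ⟨c, rfl⟩
  have h' : W * algebraMap k F (3 * c - l) = algebraMap k F (c ^ 3 + 1) := by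
    rw [map_sub, map_mul, map_ofNat, h, map_add, map_pow, map_one]
  by_cases hc : 3 * c - l = 0
  · rw [hc, map_zero, mul_zero, eq_comm, map_eq_zero] at h'
    apply hl
    linear_combination 27 * h' - ((3 * c) ^ 2 + 3 * c * l + l ^ 2) * hc
  · refine hW ⟨(c ^ 3 + 1) / (3 * c - l), ?_⟩
    rw [map_div₀, ← h', mul_div_cancel_right₀]
    exact (_root_.map_ne_zero _).mpr hc

/-- If the valuations of `W` at its poles are divisible by four, then the tripling produces an
unramified cover and a function `t` whose ramification over the images of the flexes is even. -/
theorem exists_tripling [IsAlgClosed k] (h3 : (3 : k) ≠ 0) {ζ l l' μ : k}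
    (hζ : ζ ^ 2 + ζ + 1 = 0) (hl : l ^ 3 + 27 ≠ 0) (hμ : μ ^ 3 = l ^ 3 + 27)
    (hl' : l' = -3 * l / μ) {W Y : C.FunctionField} (hW : W ∉ (algebraMap k _).range)
    (h : Y ^ 2 + (algebraMap k _ l' * W + 1) * Y + W ^ 3 = 0)
    (hpole : ∀ Q : C.Point, 1 < Q.val W → Q.IsPow 4 W) :
    ∃ (C' : SmoothCurve k) (τ : Cover C' C) (t : C'.FunctionField), τ.IsImmediate ∧
      t ∉ (algebraMap k _).range ∧
      (∀ (Q : C'.Point) (z : k), z ^ 3 = 1 → Q.IsPow 2 (t + algebraMap k _ z)) ∧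
      ∀ Q : C'.Point, Q.val (3 * t - algebraMap k _ l) < 1 →
        Q.IsPow 4 (3 * t - algebraMap k _ l) := by
  have hμ0 : μ ≠ 0 := by
    rintro rfl
    exact hl (by rw [← hμ]; simp)
  have h27 : (27 : k) ≠ 0 := by
    rw [show (27 : k) = 3 ^ 3 by norm_num]; exact pow_ne_zero 3 h3
  have h9 : (9 : k) ≠ 0 := by
    rw [show (9 : k) = 3 ^ 2 by norm_num]; exact pow_ne_zero 2 h3
  -- The parameter change is an involution: 9 / μ is to l' what μ is to l, so the second half
  -- returns from l' to l.
  have hμ' : (9 / μ) ^ 3 = l' ^ 3 + 27 := by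
    rw [hl']
    field_simp
    rw [hμ]; ring
  have hl'0 : l' ^ 3 + 27 ≠ 0 := by
    rw [← hμ']; exact pow_ne_zero 3 (div_ne_zero h9 hμ0)
  have hl'' : l = -3 * l' / (9 / μ) := by
    rw [hl']
    field_simp
    ring
  have hW0 : W ≠ 0 := by
    rintro rfl
    exact hW ⟨0, map_zero _⟩
  obtain ⟨C₁, τ₁, t₁, W₁, Y₁, hτ₁, ht₁, hW₁, hY₁⟩ :=
    exists_half_tripling h3 hζ (div_ne_zero h9 hμ0) hμ' hl'' hW0 h
  have hW₁0 : W₁ ≠ 0 := by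
    rintro rfl
    rw [zero_mul, eq_comm, neg_eq_zero, map_eq_zero] at hW₁
    exact div_ne_zero h9 hμ0 hW₁
  obtain ⟨C₂, τ₂, t₂, W₂, Y₂, hτ₂, ht₂, hW₂, hY₂⟩ :=
    exists_half_tripling h3 hζ hμ0 hμ hl' hW₁0 hY₁
  have range_pullback : ∀ {A B : SmoothCurve k} (f : Cover A B) {x : B.FunctionField},
      x ∉ (algebraMap k _).range → f.pullback x ∉ (algebraMap k _).range := by
    rintro A B f x hx ⟨c, hc⟩
    refine hx ⟨c, f.pullback.injective ?_⟩
    exact (f.pullback.commutes c).trans hc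
  have ht₁c := notMem_range_of_mul_eq hl'0 (range_pullback τ₁ hW) ht₁
  have hW₁c : W₁ ∉ (algebraMap k _).range := by
    rintro ⟨c, rfl⟩
    have hc : c ≠ 0 := by rintro rfl; exact hW₁0 (map_zero _)
    refine ht₁c ⟨(-(9 / μ) / c + l') / 3, ?_⟩
    have hc' : algebraMap k C₁.FunctionField c ≠ 0 := by simpa using hc
    have h3' : (3 : C₁.FunctionField) ≠ 0 := by
      rw [← map_ofNat (algebraMap k _) 3]; simpa using h3
    rw [map_div₀, map_add, map_div₀, map_neg, ← hW₁, mul_div_cancel_left₀ _ hc', map_ofNat]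
    field_simp
    ring
  refine ⟨C₂, τ₁.comp τ₂, t₂, hτ₁.comp hτ₂, notMem_range_of_mul_eq hl
    (range_pullback τ₂ hW₁c) ht₂, ?_⟩
  have unit : ∀ {A : SmoothCurve k} (Q : A.Point) {c : k}, c ^ 3 + 27 ≠ 0 →
      Q.val (algebraMap k _ c ^ 3 + 27) = 1 := by
    intro A Q c hc
    rw [← Q.val_algebraMap hc, map_add (algebraMap _ _), map_pow (algebraMap _ _), map_ofNat]
  have sqrt : ∀ {A : SmoothCurve k} (Q : A.Point) (a b : A.FunctionField),
      Q.val a ^ 2 = Q.val b ^ 4 → Q.val a = Q.val b ^ 2 := by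
    intro A Q a b hab
    exact (pow_left_inj₀ zero_le zero_le two_ne_zero).mp (by rw [hab, ← pow_mul])
  -- Zeros of W₁ are poles of t₁; there W has the value of t₁², so divisibility by 4 for W gives
  -- divisibility by 2 for t₁ and for W₁. Poles of W₁ are zeros of 3 t₁ - l', where W and W₁ have
  -- the same value.
  have poles₁ : ∀ Q : C₁.Point, (Q.val W₁ < 1 → Q.IsPow 2 W₁) ∧ (1 < Q.val W₁ → Q.IsPow 4 W₁) := by
    intro Q
    have hs1 : Q.val W₁ * Q.val (3 * t₁ - algebraMap k _ l') = 1 := by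
      rw [← map_mul, hW₁, Valuation.map_neg, Q.val_algebraMap (div_ne_zero h9 hμ0)]
    have hpos := Q.val_pos hW₁0
    have hp : 1 < Q.val (τ₁.pullback W) → Q.IsPow 4 (τ₁.pullback W) := fun hlt =>
      (hpole (τ₁.onPoints Q) (by simpa using (τ₁.val_pullback_lt Q (a := 1)).mp (by simpa using hlt))).pullback
    have hl'1 := Q.val_algebraMap_le_one l'
    constructor
    · intro hlt
      have ht : 1 < Q.val t₁ := by
        by_contra! hle
        have : Q.val (3 * t₁ - algebraMap k _ l') ≤ 1 := by
          refine (Valuation.map_sub _ _ _).trans (max_le ?_ hl'1)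
          rw [map_mul, Q.val_ofNat h3, one_mul]; exact hle
        exact (mul_lt_one_of_lt_of_le hlt this).ne hs1
      have hWt := Q.val.eq_sq_of_pole (Q.val_ofNat h3) hl'1 ht₁ ht
      obtain ⟨a, ha⟩ := hp (by rw [hWt]; exact one_lt_pow₀ ht two_ne_zero)
      rw [hWt] at ha
      rw [Q.val.map_three_mul_sub (Q.val_ofNat h3) hl'1 ht, sqrt Q _ _ ha] at hs1
      exact ⟨a⁻¹, by rw [map_inv₀, inv_pow]; exact eq_inv_of_mul_eq_one_left hs1⟩
    · intro hlt
      have hs : Q.val (3 * t₁ - algebraMap k _ l') < 1 := by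
        by_contra! hge
        exact (one_lt_mul_of_lt_of_le hlt hge).ne' hs1
      have hWs := Q.val.mul_eq_one_of_zero (Q.val_ofNat h3) hl'1 (unit Q hl'0) ht₁ hs
      have e : Q.val W₁ = Q.val (τ₁.pullback W) := by
        rw [eq_inv_of_mul_eq_one_left hs1, eq_inv_of_mul_eq_one_left hWs]
      obtain ⟨a, ha⟩ := hp (by rwa [← e])
      exact ⟨a, e.trans ha⟩
  have poles₂ : ∀ Q : C₂.Point, (Q.val (τ₂.pullback W₁) < 1 → Q.IsPow 2 (τ₂.pullback W₁)) ∧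
      (1 < Q.val (τ₂.pullback W₁) → Q.IsPow 4 (τ₂.pullback W₁)) := fun Q =>
    ⟨fun hlt => ((poles₁ _).1 ((τ₂.val_pullback_lt_one Q).mp hlt)).pullback, fun hlt =>
      ((poles₁ _).2 (by simpa using (τ₂.val_pullback_lt Q (a := 1)).mp (by simpa using hlt))).pullback⟩
  -- Zeros of t₂ + z are zeros of W₁ of the same order; at poles of t₂, W₁ has the value of t₂², and
  -- at zeros of 3 t₂ - l it has the inverse value.
  constructor
  · intro Q z hz
    have hl1 := Q.val_algebraMap_le_one l
    have hz1 := Q.val_algebraMap_le_one z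
    rcases lt_trichotomy (Q.val (t₂ + algebraMap k _ z)) 1 with hlt | heq | hgt
    · have e := Q.val.eq_of_cube_root_of_neg_one (Q.val_ofNat h3) hl1 (unit Q hl) ht₂
        (by rw [← map_pow, hz, map_one]) hlt
      obtain ⟨a, ha⟩ := (poles₂ Q).1 (by rwa [e])
      exact ⟨a, e.symm.trans ha⟩
    · exact ⟨1, by simpa using heq⟩
    · have ht : 1 < Q.val t₂ := by
        by_contra! hle
        exact hgt.not_ge (Valuation.map_add_le _ hle hz1)
      have e : Q.val (t₂ + algebraMap k _ z) = Q.val t₂ :=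
        Valuation.map_add_eq_of_lt_left _ (hz1.trans_lt ht)
      have hWt := Q.val.eq_sq_of_pole (Q.val_ofNat h3) hl1 ht₂ ht
      obtain ⟨a, ha⟩ := (poles₂ Q).2 (by rw [hWt]; exact one_lt_pow₀ ht two_ne_zero)
      exact ⟨a, e.trans (sqrt Q _ _ (hWt.symm.trans ha))⟩
  · intro Q hs
    have hl1 := Q.val_algebraMap_le_one l
    have hWs := Q.val.mul_eq_one_of_zero (Q.val_ofNat h3) hl1 (unit Q hl) ht₂ hs
    have hgt : 1 < Q.val (τ₂.pullback W₁) := by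
      by_contra! hle
      exact ((mul_le_of_le_one_left' hle).trans_lt hs).ne hWs
    obtain ⟨a, ha⟩ := (poles₂ Q).2 hgt
    exact ⟨a⁻¹, by rw [eq_inv_of_mul_eq_one_right hWs, ha, map_inv₀, inv_pow]⟩

end SmoothCurve

/-! ### The chord construction and reflections -/

section Chord

variable {F : Type*} [Field F] {l a b W Y L W' : F}

/-- The third point on a chord of the curve `y² + (l w + 1) y + w³ = 0`. -/
theorem chord_third_point (hWa : W - a ≠ 0) (hab : b ^ 2 + (l * a + 1) * b + a ^ 3 = 0)
    (h : Y ^ 2 + (l * W + 1) * Y + W ^ 3 = 0) (hL : L * (W - a) = Y - b)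
    (hW' : W' + L ^ 2 + l * L + W + a = 0) :
    (b + L * (W' - a)) ^ 2 + (l * W' + 1) * (b + L * (W' - a)) + W' ^ 3 = 0 := by
  have hg : L * (2 * b + L * (W - a)) + l * b + (l * W + 1) * L + W ^ 2 + a * W + a ^ 2 = 0 := by
    apply mul_left_cancel₀ hWa
    rw [show Y = b + L * (W - a) by linear_combination -hL] at h
    linear_combination h - hab
  linear_combination (W' - a) * hg + hab + (W' - a) * (W' - W) * hW'

/-- A second expression for the slope, from subtracting the equations of the two points. It remains
usable when W - a and Y - b vanish together. -/
theorem chord_slope_mul (hWa : W - a ≠ 0) (hab : b ^ 2 + (l * a + 1) * b + a ^ 3 = 0)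
    (h : Y ^ 2 + (l * W + 1) * Y + W ^ 3 = 0) (hL : L * (W - a) = Y - b) :
    L * (Y + b + l * W + 1) = -(l * b + (W ^ 2 + W * a + a ^ 2)) := by
  apply mul_left_cancel₀ hWa
  linear_combination (Y + b + l * W + 1) * hL + h - hab

/-- At a pole of W the right side has at most the pole of W², which shows that the third point stays
finite there. -/
theorem chord_third_mul_sq (hab : b ^ 2 + (l * a + 1) * b + a ^ 3 = 0)
    (h : Y ^ 2 + (l * W + 1) * Y + W ^ 3 = 0) (hL : L * (W - a) = Y - b)
    (hW' : W' + L ^ 2 + l * L + W + a = 0) :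
    W' * (W - a) ^ 2 = Y * (1 + 2 * b + l * a) + a * W ^ 2 + (a ^ 2 + l * b) * W + b := by
  linear_combination (W - a) ^ 2 * hW' - (L * (W - a) + (Y - b) + l * (W - a)) * hL - h - hab

/-- The curve `y² + (l w + 1) y + w³ = 0` is smooth for `l³ ≠ -27`. -/
theorem tripling_smooth (h3 : (3 : F) ≠ 0) (hl : l ^ 3 + 27 ≠ 0)
    (hab : b ^ 2 + (l * a + 1) * b + a ^ 3 = 0) (h1 : 2 * b + l * a + 1 = 0) :
    l * b + 3 * a ^ 2 ≠ 0 := by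
  intro h2
  have hb : b ^ 2 = a ^ 3 := by linear_combination b * h1 - hab
  have ha0 : a ≠ 0 := by
    rintro rfl
    have : b = 0 := by simpa using hb
    subst this
    simp at h1
  have h4 : l ^ 2 = 9 * a := by
    apply mul_left_cancel₀ (pow_ne_zero 3 ha0)
    linear_combination (l * b - 3 * a ^ 2) * h2 - l ^ 2 * hb
  have h5 : l = -(3 * a ^ 2) := by
    linear_combination l * h1 - 2 * h2 - a * h4
  have h6 : a ^ 3 = 1 := by
    have : (3 ^ 2 * a) * (a ^ 3 - 1) = 0 := by
      rw [h5] at h4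
      linear_combination h4
    have := (mul_eq_zero.mp this).resolve_left (mul_ne_zero (pow_ne_zero 2 h3) ha0)
    linear_combination this
  apply hl
  rw [h5]
  linear_combination -27 * (a ^ 3 + 1) * h6

end Chord

namespace SmoothCurve

variable {k : Type u} [Field k] {C : SmoothCurve k}

/-- Reflecting the curve `y² + (l w + 1) y + w³ = 0` moves a given point to infinity. -/
theorem exists_reflection [IsAlgClosed k] (h3 : (3 : k) ≠ 0) {l : k} (hl : l ^ 3 + 27 ≠ 0)
    {W Y : C.FunctionField} (hW : W ∉ (algebraMap k _).range)
    (h : Y ^ 2 + (algebraMap k _ l * W + 1) * Y + W ^ 3 = 0) (Q₀ : C.Point) (hQ₀ : Q₀.val W ≤ 1) :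
    ∃ (W' Y' : C.FunctionField) (a b : k),
      Y' ^ 2 + (algebraMap k _ l * W' + 1) * Y' + W' ^ 3 = 0 ∧ 1 < Q₀.val W' ∧
      (∀ K : IntermediateField k C.FunctionField, W' ∈ K → Y' ∈ K → W ∈ K ∧ Y ∈ K) ∧
      b ^ 2 + (l * a + 1) * b + a ^ 3 = 0 ∧ Q₀.val (W - algebraMap k _ a) < 1 ∧
      ∀ Q : C.Point, 1 < Q.val W' → 2 * b + l * a + 1 ≠ 0 →
        Q.val W' * Q.val (W - algebraMap k _ a) ^ 2 = 1 := by
  obtain ⟨a, ha⟩ := Q₀.exists_val_sub_lt_one hQ₀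
  have hYint : ∀ Q : C.Point, Q.val W ≤ 1 → Q.val Y ≤ 1 := fun Q hQ =>
    Q.val.le_one_of_monic_quadratic (Q.val_algebraMap_le_one l) h hQ
  obtain ⟨y₀, hy₀⟩ := Q₀.exists_val_sub_lt_one (hYint Q₀ hQ₀)
  set A := algebraMap k C.FunctionField with hA
  have hconst : ∀ c : k, Q₀.val (A c) < 1 → c = 0 := fun c hc => by
    by_contra hc0
    exact hc.ne (Q₀.val_algebraMap hc0)
  have mul_lt : ∀ (Q : C.Point) (x y : C.FunctionField), Q.val x < 1 → Q.val y ≤ 1 →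
      Q.val (x * y) < 1 := fun Q x y hx hy => by
    rw [map_mul]; exact (mul_le_of_le_one_right' hy).trans_lt hx
  have hcle := fun (Q : C.Point) (c : k) => Q.val_algebraMap_le_one c
  have add_le : ∀ (Q : C.Point) (x y : C.FunctionField), Q.val x ≤ 1 → Q.val y ≤ 1 →
      Q.val (x + y) ≤ 1 := fun Q x y hx hy => Valuation.map_add_le _ hx hy
  have mul_le : ∀ (Q : C.Point) (x y : C.FunctionField), Q.val x ≤ 1 → Q.val y ≤ 1 →
      Q.val (x * y) ≤ 1 := fun Q x y hx hy => by rw [map_mul]; exact mul_le_one' hx hy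
  have pow_le : ∀ (Q : C.Point) (x : C.FunctionField) (n : ℕ), Q.val x ≤ 1 → Q.val (x ^ n) ≤ 1 :=
    fun Q x n hx => by rw [map_pow]; exact pow_le_one' hx n
  have hy₀eq : y₀ ^ 2 + (l * a + 1) * y₀ + a ^ 3 = 0 := by
    apply hconst
    have e : A (y₀ ^ 2 + (l * a + 1) * y₀ + a ^ 3) =
        -((Y - A y₀) * (Y + A y₀ + (A l * W + 1)) + (W - A a) *
          (A (l * y₀) + (W ^ 2 + W * A a + A a ^ 2))) := by
      simp only [map_add, map_mul, map_pow, map_one]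
      linear_combination h
    rw [e, Valuation.map_neg]
    refine Valuation.map_add_lt _ (mul_lt _ _ _ hy₀ ?_) (mul_lt _ _ _ ha ?_)
    · exact add_le _ _ _ (add_le _ _ _ (hYint _ hQ₀) (hcle _ _))
        (add_le _ _ _ (mul_le _ _ _ (hcle _ _) hQ₀) (by simp))
    · exact add_le _ _ _ (hcle _ _) (add_le _ _ _ (add_le _ _ _ (pow_le _ _ _ hQ₀)
        (mul_le _ _ _ hQ₀ (hcle _ _))) (pow_le _ _ _ (hcle _ _)))
  -- (a, y₀) is the image of Q₀ and (a, b) its negative. The third point on the chord through (a, b)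
  -- and P is (a, y₀) - P in the group law, so P = (a, y₀) goes to infinity.
  set b := -y₀ - l * a - 1 with hb
  have hab : b ^ 2 + (l * a + 1) * b + a ^ 3 = 0 := by
    rw [hb]; linear_combination hy₀eq
  have habF : A b ^ 2 + (A l * A a + 1) * A b + A a ^ 3 = 0 := by
    have := congrArg A hab
    simpa only [map_add, map_mul, map_pow, map_one, map_zero] using this
  have hWa : W - A a ≠ 0 := fun h0 => hW ⟨a, (sub_eq_zero.mp h0).symm⟩
  set L := (Y - A b) / (W - A a) with hLdef
  have hL : L * (W - A a) = Y - A b := div_mul_cancel₀ _ hWa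
  set W' := -L ^ 2 - A l * L - W - A a with hW'def
  have hW' : W' + L ^ 2 + A l * L + W + A a = 0 := by rw [hW'def]; ring
  have hy₀b : A y₀ = -A b - A l * A a - 1 := by
    rw [hb]; simp only [map_sub, map_neg, map_mul, map_one]; ring
  have hslope : L * ((Y - A y₀) + (W - A a) * A l) = -(A (l * b) + (W ^ 2 + W * A a + A a ^ 2)) := by
    rw [map_mul, ← chord_slope_mul hWa habF h hL, hy₀b]; ring
  have hW'L : ∀ Q : C.Point, Q.val W ≤ 1 → 1 < Q.val L → Q.val W' = Q.val L ^ 2 := by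
    intro Q hQ hlt
    rw [show W' = -(L ^ 2 + (A l * L + W + A a)) by rw [hW'def]; ring, Valuation.map_neg,
      Valuation.map_add_eq_of_lt_left, map_pow]
    rw [map_pow]
    have : Q.val L < Q.val L ^ 2 := by
      rw [sq]; exact lt_mul_of_one_lt_left (zero_lt_one.trans hlt) hlt
    refine lt_of_le_of_lt ?_ this
    refine Valuation.map_add_le _ (Valuation.map_add_le _ ?_ (hQ.trans hlt.le))
      ((hcle Q _).trans hlt.le)
    rw [map_mul]
    exact mul_le_of_le_one_left' (hcle Q _)
  have hpole₀ : 1 < Q₀.val W' := by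
    suffices hlt : 1 < Q₀.val L by
      rw [hW'L Q₀ hQ₀ hlt]; exact one_lt_pow₀ hlt two_ne_zero
    by_contra! hle
    -- In the first case (a, b) is its own negative and the chord degenerates to a tangent: the
    -- second slope formula has a non-zero numerator by smoothness. Otherwise the numerator Y - b is
    -- already non-zero at Q₀.
    by_cases hbb : 2 * b + l * a + 1 = 0
    · have hne := tripling_smooth h3 hl hab hbb
      apply hne
      apply hconst
      have e : A (l * b + 3 * a ^ 2) = -(((Y - A y₀) + (W - A a) * A l) * L +
          (W - A a) * (W + A a + A a)) := by
        rw [mul_comm _ L, hslope]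
        simp only [map_add, map_mul, map_pow, map_ofNat]
        ring
      rw [e, Valuation.map_neg]
      refine Valuation.map_add_lt _ (mul_lt _ _ _ (Valuation.map_add_lt _ hy₀
        (mul_lt _ _ _ ha (hcle _ _))) hle) (mul_lt _ _ _ ha ?_)
      exact add_le _ _ _ (add_le _ _ _ hQ₀ (hcle _ _)) (hcle _ _)
    · apply hbb
      apply hconst
      have e : A (2 * b + l * a + 1) = (W - A a) * L * (-1) + (Y - A y₀) := by
        rw [mul_comm (W - A a), hL, hy₀b]
        simp only [map_add, map_mul, map_one, map_ofNat]
        ring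
      rw [e]
      exact Valuation.map_add_lt _ (mul_lt _ _ _ (mul_lt _ _ _ ha hle) (by simp)) hy₀
  refine ⟨W', A b + L * (W' - A a), a, b, chord_third_point hWa habF h hL hW', hpole₀, ?_, hab, ha,
    ?_⟩
  -- The chord through (a, b) and the new point is the same line, so its slope L lies in K and the
  -- reflection can be inverted.
  · intro K hW'K hY'K
    have hac : ∀ c : k, A c ∈ K := fun c => K.algebraMap_mem c
    have hW'a : W' - A a ≠ 0 := fun h0 =>
      Q₀.notMem_range_of_one_lt_val hpole₀ ⟨a, (sub_eq_zero.mp h0).symm⟩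
    have hLK : L ∈ K := by
      have : L = (A b + L * (W' - A a) - A b) / (W' - A a) := by field_simp; ring
      rw [this]
      exact div_mem (sub_mem hY'K (hac b)) (sub_mem hW'K (hac a))
    have hWK : W ∈ K := by
      rw [show W = -(W' + L ^ 2 + A l * L + A a) by linear_combination hW']
      exact neg_mem (add_mem (add_mem (add_mem hW'K (pow_mem hLK 2)) (mul_mem (hac l) hLK)) (hac a))
    refine ⟨hWK, ?_⟩
    rw [show Y = A b + L * (W - A a) by linear_combination -hL]
    exact add_mem (hac b) (mul_mem hLK (sub_mem hWK (hac a)))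
  · intro Q hQ hbb
    -- A pole of W' is not a pole of W. There L has a pole, which forces W = a and Y = y₀ at Q, and
    -- Y - b is then a unit; so W' has the value of (W - a)⁻².
    have hQW : Q.val W ≤ 1 := by
      by_contra! hlt
      have hpos := zero_lt_one.trans hlt
      have hlt2 : 1 ≤ Q.val W ^ 2 := one_le_pow₀ hlt.le
      have hWle : Q.val W ≤ Q.val W ^ 2 := by
        rw [sq]; exact le_mul_of_one_le_left zero_le hlt.le
      have hYW : Q.val Y ≤ Q.val W ^ 2 := by
        have h1 := Q.val.sq_eq_cube_of_pole (hcle Q l) h hlt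
        refine (pow_le_pow_iff_left₀ zero_le zero_le two_ne_zero).mp ?_
        rw [h1, ← pow_mul]
        exact pow_le_pow_right₀ hlt.le (by norm_num)
      have hval : Q.val (W - A a) = Q.val W :=
        Valuation.map_sub_eq_of_lt_left _ ((hcle Q a).trans_lt hlt)
      have h1 := congrArg Q.val (chord_third_mul_sq habF h hL hW')
      rw [map_mul, map_pow, hval] at h1
      have h2 : Q.val (Y * (1 + 2 * A b + A l * A a) + A a * W ^ 2 + (A a ^ 2 + A l * A b) * W +
          A b) ≤ Q.val W ^ 2 := by
        have e1 : 1 + 2 * A b + A l * A a = A (1 + 2 * b + l * a) := by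
          simp only [map_add, map_mul, map_one, map_ofNat]
        have e2 : A a ^ 2 + A l * A b = A (a ^ 2 + l * b) := by
          simp only [map_add, map_mul, map_pow]
        rw [e1, e2]
        refine Valuation.map_add_le _ (Valuation.map_add_le _ (Valuation.map_add_le _ ?_ ?_) ?_)
          ((hcle Q b).trans hlt2)
        · rw [map_mul]; exact (mul_le_of_le_one_right' (hcle Q _)).trans hYW
        · rw [map_mul, map_pow]; exact mul_le_of_le_one_left' (hcle Q _)
        · rw [map_mul]; exact (mul_le_of_le_one_left' (hcle Q _)).trans hWle
      rw [← h1] at h2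
      exact h2.not_gt (lt_mul_of_one_lt_left (pow_pos hpos 2) hQ)
    have hLgt : 1 < Q.val L := by
      by_contra! hle
      refine hQ.not_ge ?_
      rw [show W' = -(L ^ 2 + (A l * L + (W + A a))) by rw [hW'def]; ring, Valuation.map_neg]
      exact add_le _ _ _ (pow_le _ _ _ hle) (add_le _ _ _ (mul_le _ _ _ (hcle _ _) hle)
        (add_le _ _ _ hQW (hcle _ _)))
    have hYQ := hYint Q hQW
    have hWa1 : Q.val (W - A a) < 1 := by
      by_contra! hge
      have h1 := congrArg Q.val hL
      rw [map_mul] at h1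
      have h2 : Q.val (Y - A b) ≤ 1 := (Valuation.map_sub _ _ _).trans (max_le hYQ (hcle Q b))
      rw [← h1] at h2
      exact h2.not_gt (one_lt_mul_of_lt_of_le hLgt hge)
    have hYy : Q.val ((Y - A y₀) + (W - A a) * A l) < 1 := by
      by_contra! hge
      have h1 := congrArg Q.val hslope
      rw [map_mul, Valuation.map_neg] at h1
      have h2 : Q.val (A (l * b) + (W ^ 2 + W * A a + A a ^ 2)) ≤ 1 :=
        add_le _ _ _ (hcle _ _) (add_le _ _ _ (add_le _ _ _ (pow_le _ _ _ hQW)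
          (mul_le _ _ _ hQW (hcle _ _))) (pow_le _ _ _ (hcle _ _)))
      rw [← h1] at h2
      exact h2.not_gt (one_lt_mul_of_lt_of_le hLgt hge)
    have hYb : Q.val (Y - A b) = 1 := by
      have e : Y - A b = (-A (2 * b + l * a + 1)) + ((Y - A y₀) + (W - A a) * A l +
          (W - A a) * (-A l)) := by
        rw [hy₀b]
        simp only [map_add, map_mul, map_one, map_ofNat]
        ring
      have h1 : Q.val (-A (2 * b + l * a + 1)) = 1 := by
        rw [Valuation.map_neg, Q.val_algebraMap hbb]
      rw [e, Valuation.map_add_eq_of_lt_left, h1]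
      rw [h1]
      refine Valuation.map_add_lt _ hYy (mul_lt _ _ _ hWa1 ?_)
      rw [Valuation.map_neg]; exact hcle _ _
    rw [hW'L Q hQW hLgt, ← mul_pow, ← map_mul, hL, hYb, one_pow]

end SmoothCurve

/-! ### The unique point at infinity and the starting data on `C` -/

namespace SmoothCurve

variable {k : Type u} [Field k] {C D : SmoothCurve k}

theorem Point.val_aeval_of_pole (Q : C.Point) {W : C.FunctionField} (hW : 1 < Q.val W) {p : k[X]}
    (hp : p ≠ 0) : Q.val (aeval W p) = Q.val W ^ p.natDegree := by
  have hlead : Q.val (algebraMap k _ (p.coeff p.natDegree) * W ^ p.natDegree) =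
      Q.val W ^ p.natDegree := by
    rw [map_mul, map_pow, coeff_natDegree, Q.val_algebraMap (leadingCoeff_ne_zero.mpr hp), one_mul]
  rw [aeval_eq_sum_range, Finset.sum_range_succ]
  simp only [Algebra.smul_def]
  rw [Valuation.map_add_eq_of_lt_right, hlead]
  rw [hlead]
  refine Valuation.map_sum_lt _ (pow_ne_zero _ (zero_lt_one.trans hW).ne') fun i hi => ?_
  rw [map_mul, map_pow]
  exact (mul_le_of_le_one_left' (Q.val_algebraMap_le_one _)).trans_lt
    (pow_lt_pow_right₀ hW (Finset.mem_range.mp hi))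

section

variable {l : k} {W Y : C.FunctionField} (h : Y ^ 2 + (algebraMap k _ l * W + 1) * Y + W ^ 3 = 0)
include h

/-- Parity: squaring turns the two values into an even and an odd power of the value of W, since Y²
has the value of W³. -/
theorem Point.val_ne_of_pole (Q : C.Point) (hW : 1 < Q.val W) {p q : k[X]} (hp : p ≠ 0)
    (hq : q ≠ 0) : Q.val (aeval W p) ≠ Q.val (aeval W q * Y) := by
  intro heq
  have h1 := congrArg (· ^ 2) heq
  simp only [map_mul, mul_pow] at h1
  rw [Q.val.sq_eq_cube_of_pole (Q.val_algebraMap_le_one l) h hW, Q.val_aeval_of_pole hW hp,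
    Q.val_aeval_of_pole hW hq, ← pow_mul, ← pow_mul, ← pow_add] at h1
  have := (pow_right_injective₀ (zero_lt_one.trans hW) hW.ne') h1
  omega

/-- The two summands have distinct values, so no cancellation occurs and regularity depends only on
degrees, not on the chosen point. -/
theorem Point.val_le_one_iff_of_pole (Q : C.Point) (hW : 1 < Q.val W) {p q r : k[X]} (hr : r ≠ 0)
    {f : C.FunctionField} (hf : f * aeval W r = aeval W p + aeval W q * Y) :
    Q.val f ≤ 1 ↔ (p = 0 ∨ p.natDegree ≤ r.natDegree) ∧
      (q = 0 ∨ 2 * q.natDegree + 3 ≤ 2 * r.natDegree) := by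
  have hr0 : 0 < Q.val (aeval W r) := by
    rw [Q.val_aeval_of_pole hW hr]; exact pow_pos (zero_lt_one.trans hW) _
  have h1 : Q.val f ≤ 1 ↔ Q.val (aeval W p + aeval W q * Y) ≤ Q.val (aeval W r) := by
    rw [← hf, map_mul, mul_le_iff_le_one_left hr0]
  have hp : Q.val (aeval W p) ≤ Q.val (aeval W r) ↔ p = 0 ∨ p.natDegree ≤ r.natDegree := by
    by_cases hp : p = 0
    · simp [hp]
    · rw [Q.val_aeval_of_pole hW hr, Q.val_aeval_of_pole hW hp, pow_le_pow_iff_right₀ hW]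
      simp [hp]
  have hq : Q.val (aeval W q * Y) ≤ Q.val (aeval W r) ↔
      q = 0 ∨ 2 * q.natDegree + 3 ≤ 2 * r.natDegree := by
    by_cases hq : q = 0
    · simp [hq]
    · rw [← pow_le_pow_iff_left₀ zero_le zero_le two_ne_zero, map_mul, mul_pow,
        Q.val.sq_eq_cube_of_pole (Q.val_algebraMap_le_one l) h hW, Q.val_aeval_of_pole hW hr,
        Q.val_aeval_of_pole hW hq, ← pow_mul, ← pow_mul, ← pow_add, pow_le_pow_iff_right₀ hW]
      simp only [hq, false_or]
      omega
  rw [h1, ← hp, ← hq]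
  constructor
  · intro hle
    by_cases hp0 : p = 0
    · simpa [hp0] using hle
    by_cases hq0 : q = 0
    · simpa [hq0] using hle
    rw [Valuation.map_add_of_distinct_val _ (Q.val_ne_of_pole h hW hp0 hq0)] at hle
    exact max_le_iff.mp hle
  · rintro ⟨h2, h3⟩
    exact Valuation.map_add_le _ h2 h3

theorem exists_eq_add_mul_div_of_adjoin_eq_top (Q : C.Point) (hW : 1 < Q.val W)
    (htop : IntermediateField.adjoin k {W, Y} = ⊤) (f : C.FunctionField) :
    ∃ p q r : k[X], r ≠ 0 ∧ f * aeval W r = aeval W p + aeval W q * Y := by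
  have hmem : f ∈ IntermediateField.adjoin k {W, Y} := htop ▸ IntermediateField.mem_top
  have hc : ∀ c : k, algebraMap k C.FunctionField c = aeval W (Polynomial.C c) := fun c =>
    (aeval_C W c).symm
  induction hmem using IntermediateField.adjoin_induction with
  | mem x hx =>
    rcases hx with rfl | rfl
    · exact ⟨X, 0, 1, one_ne_zero, by simp⟩
    · exact ⟨0, 1, 1, one_ne_zero, by simp⟩
  | algebraMap x => exact ⟨Polynomial.C x, 0, 1, one_ne_zero, by simp⟩
  | add x y _ _ hx hy =>
    obtain ⟨p, q, r, hr, e⟩ := hx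
    obtain ⟨p', q', r', hr', e'⟩ := hy
    refine ⟨p * r' + p' * r, q * r' + q' * r, r * r', mul_ne_zero hr hr', ?_⟩
    simp only [map_add, map_mul]
    linear_combination aeval W r' * e + aeval W r * e'
  | inv x _ hx =>
    obtain ⟨p, q, r, hr, e⟩ := hx
    by_cases hx0 : x = 0
    · exact ⟨0, 0, 1, one_ne_zero, by simp [hx0]⟩
    have hr0 : aeval W r ≠ 0 := by
      rw [← Valuation.ne_zero_iff Q.val, Q.val_aeval_of_pole hW hr]
      exact pow_ne_zero _ (zero_lt_one.trans hW).ne'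
    -- The conjugate of Y over k(W) satisfies the same equation; inverses are computed by
    -- multiplying with the conjugate.
    have hσ : (-Y - algebraMap k _ l * W - 1) ^ 2 +
        (algebraMap k _ l * W + 1) * (-Y - algebraMap k _ l * W - 1) + W ^ 3 = 0 := by
      linear_combination h
    have hconj : aeval W p + aeval W q * (-Y - algebraMap k _ l * W - 1) ≠ 0 := by
      intro h0
      have hval : ∀ {a : k[X]}, a ≠ 0 → aeval W a ≠ 0 := fun {a} ha => by
        rw [← Valuation.ne_zero_iff Q.val, Q.val_aeval_of_pole hW ha]
        exact pow_ne_zero _ (zero_lt_one.trans hW).ne'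
      have hY0 : -Y - algebraMap k _ l * W - 1 ≠ 0 := by
        intro h1
        rw [h1] at hσ
        have : W = 0 := by simpa using hσ
        simp [this] at hW
      by_cases hq0 : q = 0
      · by_cases hp0 : p = 0
        · subst hq0 hp0
          simp only [map_zero, zero_mul, add_zero, mul_eq_zero] at e
          exact e.elim hx0 hr0
        · exact hval hp0 (by simpa [hq0] using h0)
      · by_cases hp0 : p = 0
        · rw [hp0, map_zero, zero_add] at h0
          exact (mul_ne_zero (hval hq0) hY0) h0
        · apply Q.val_ne_of_pole hσ hW hp0 hq0
          rw [← Valuation.map_neg, neg_eq_of_add_eq_zero_right h0]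
    have hnum : aeval W p + aeval W q * Y ≠ 0 := by
      rw [← e]; exact mul_ne_zero hx0 hr0
    have hN : aeval W (p ^ 2 - p * q * (Polynomial.C l * X + 1) + q ^ 2 * X ^ 3) =
        (aeval W p + aeval W q * Y) *
          (aeval W p + aeval W q * (-Y - algebraMap k _ l * W - 1)) := by
      simp only [map_add, map_mul, map_sub, map_pow, aeval_X, aeval_C, map_one]
      linear_combination (aeval W q) ^ 2 * h
    refine ⟨r * (p - q * (Polynomial.C l * X + 1)), -(r * q),
      p ^ 2 - p * q * (Polynomial.C l * X + 1) + q ^ 2 * X ^ 3, ?_, ?_⟩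
    · intro h0
      rw [h0, map_zero] at hN
      exact mul_ne_zero hnum hconj hN.symm
    · rw [hN, ← e]
      simp only [map_add, map_mul, map_sub, map_neg, aeval_X, aeval_C, map_one]
      field_simp
      ring
  | mul x y _ _ hx hy =>
    obtain ⟨p, q, r, hr, e⟩ := hx
    obtain ⟨p', q', r', hr', e'⟩ := hy
    refine ⟨p * p' - q * q' * X ^ 3, p * q' + p' * q - q * q' * (Polynomial.C l * X + 1), r * r',
      mul_ne_zero hr hr', ?_⟩
    simp only [map_add, map_mul, map_sub, map_pow, aeval_X, aeval_C, map_one]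
    linear_combination y * aeval W r' * e + (aeval W p + aeval W q * Y) * e' +
      aeval W q * aeval W q' * h

/-- The curve `y² + (l w + 1) y + w³ = 0` has only one point at infinity. -/
theorem Point.eq_of_pole (htop : IntermediateField.adjoin k {W, Y} = ⊤) {P Q : C.Point}
    (hP : 1 < P.val W) (hQ : 1 < Q.val W) : P = Q := by
  apply Point.ext
  ext f
  obtain ⟨p, q, r, hr, e⟩ := exists_eq_add_mul_div_of_adjoin_eq_top h P hP htop f
  rw [← ValuationSubring.valuation_le_one_iff, ← ValuationSubring.valuation_le_one_iff]
  exact (P.val_le_one_iff_of_pole h hP hr e).trans (Q.val_le_one_iff_of_pole h hQ hr e).symm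

end

theorem Cover.isPow_two_of_even [IsAlgClosed k] (f : Cover C D) (Q : C.Point)
    (he : Even (f.ramificationIndex Q)) (a : D.FunctionField) : Q.IsPow 2 (f.pullback a) := by
  by_cases ha : a = 0
  · exact ⟨0, by simp [ha]⟩
  obtain ⟨π, hπ⟩ := (f.onPoints Q).exists_isUniformizer
  obtain ⟨ϖ, hϖ⟩ := Q.exists_isUniformizer
  obtain ⟨n, hn⟩ := hπ.exists_zpow a ha
  obtain ⟨m, hm⟩ := he
  refine ⟨ϖ ^ (m * n), ?_⟩
  rw [← map_zpow₀] at hn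
  rw [(f.val_pullback_eq Q).mpr hn, map_zpow₀, map_zpow₀, (f.val_ramificationIndex Q hπ hϖ).2, hm,
    map_zpow₀, ← zpow_natCast, ← zpow_mul, ← zpow_natCast (Q.val ϖ ^ (↑m * n)), ← zpow_mul]
  congr 1
  push_cast
  ring

theorem eval₂_hessePolynomial {S : Type*} [CommRing S] (lam : k) (φ : k[X] →+* S) (r : S) :
    (hessePolynomial lam).eval₂ φ r = r ^ 3 + φ (Polynomial.C lam) * φ X * r + (φ X ^ 3 + 1) := by
  rw [hessePolynomial, eval₂_add, eval₂_add, eval₂_mul, eval₂_pow, eval₂_X, eval₂_C, eval₂_C,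
    map_mul, map_add, map_pow, map_one]

/-- The function field of a Hesse cubic is generated by functions satisfying
`y² + (l' w + 1) y + w³ = 0`. -/
theorem exists_generators_hesseCubic {ζ lam μ : k} (h3 : (3 : k) ≠ 0) (hζ : ζ ^ 2 + ζ + 1 = 0)
    (hlam : lam ^ 3 + 27 ≠ 0) (hμ : μ ^ 3 = lam ^ 3 + 27) :
    ∃ W Y : (hesseCubic lam hlam).FunctionField,
      Y ^ 2 + (algebraMap k _ (-3 * lam / μ) * W + 1) * Y + W ^ 3 = 0 ∧
      IntermediateField.adjoin k {W, Y} = ⊤ := by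
  haveI : Fact (Irreducible ((hessePolynomial lam).map (algebraMap k[X] (RatFunc k)))) :=
    ⟨irreducible_hessePolynomial hlam⟩
  have hμ0 : μ ≠ 0 := by
    rintro rfl
    exact hlam (by rw [← hμ]; simp)
  have hζ1 : 1 - ζ ^ 2 ≠ 0 := by
    intro h0
    apply h3
    linear_combination (2 - ζ) * (hζ + h0) - h0
  set x : HesseFunctionField lam := algebraMap (RatFunc k) (HesseFunctionField lam) RatFunc.X with hx
  set y : HesseFunctionField lam := AdjoinRoot.root _ with hy
  have hA : ∀ c : k, algebraMap k (HesseFunctionField lam) c = AdjoinRoot.of _ (RatFunc.C c) :=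
    fun c => IsScalarTower.algebraMap_apply k (RatFunc k) (HesseFunctionField lam) c
  have hxy : x ^ 3 + y ^ 3 + 1 + algebraMap k (HesseFunctionField lam) lam * x * y = 0 := by
    have h0 := AdjoinRoot.eval₂_root ((hessePolynomial lam).map (algebraMap k[X] (RatFunc k)))
    rw [eval₂_map, eval₂_hessePolynomial, RingHom.comp_apply, RingHom.comp_apply, RatFunc.algebraMap_X,
      RatFunc.algebraMap_C, ← hA] at h0
    change y ^ 3 + algebraMap k (HesseFunctionField lam) lam * x * y + (x ^ 3 + 1) = 0 at h0
    linear_combination h0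
  have hgen : ∀ K : IntermediateField k (HesseFunctionField lam), x ∈ K → y ∈ K → K = ⊤ := by
    intro K hxK hyK
    have hpoly : ∀ p : k[X], AdjoinRoot.of ((hessePolynomial lam).map (algebraMap k[X] (RatFunc k)))
        (algebraMap k[X] (RatFunc k) p) ∈ K := by
      intro p
      induction p using Polynomial.induction_on' with
      | add p q hp hq => rw [map_add, map_add]; exact add_mem hp hq
      | monomial n c =>
        rw [← C_mul_X_pow_eq_monomial, map_mul, map_mul, map_pow, map_pow, RatFunc.algebraMap_X,
          RatFunc.algebraMap_C, ← hA]
        exact mul_mem (K.algebraMap_mem c) (pow_mem hxK n)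
    have hrat : ∀ r : RatFunc k,
        AdjoinRoot.of ((hessePolynomial lam).map (algebraMap k[X] (RatFunc k))) r ∈ K := by
      intro r
      rw [← RatFunc.num_div_denom r, map_div₀]
      exact div_mem (hpoly _) (hpoly _)
    refine top_le_iff.mp fun f _ => ?_
    obtain ⟨q, rfl⟩ := AdjoinRoot.mk_surjective f
    induction q using Polynomial.induction_on' with
    | add p q hp hq => rw [map_add]; exact add_mem (hp trivial) (hq trivial)
    | monomial n c =>
      rw [← C_mul_X_pow_eq_monomial, map_mul, map_pow, AdjoinRoot.mk_C, AdjoinRoot.mk_X]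
      exact mul_mem (hrat c) (pow_mem hyK n)
  obtain ⟨W, Y, hX, hW, hY, hWY⟩ := hesse_to_tripling (μ := algebraMap k (HesseFunctionField lam) μ)
    (ζ := algebraMap k _ ζ) (by simpa using hμ0)
    (by rw [← map_pow, hμ, map_add, map_pow, map_ofNat])
    (by rw [← map_pow, ← map_add, ← map_one (algebraMap k _), ← map_add, hζ, map_zero]) hxy
  refine ⟨W, Y, ?_, ?_⟩
  · rw [map_div₀, map_mul, map_neg, map_ofNat]
    exact hWY
  · have hWK : W ∈ IntermediateField.adjoin k {W, Y} := IntermediateField.subset_adjoin _ _ (by simp)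
    have hYK : Y ∈ IntermediateField.adjoin k {W, Y} := IntermediateField.subset_adjoin _ _ (by simp)
    have hcK := fun c : k => (IntermediateField.adjoin k {W, Y}).algebraMap_mem c
    have h3F : (3 : HesseFunctionField lam) ≠ 0 := by
      rw [← map_ofNat (algebraMap k _) 3]; simpa using h3
    have hζF : 1 - algebraMap k (HesseFunctionField lam) ζ ^ 2 ≠ 0 := by
      rw [← map_pow, ← map_one (algebraMap k _), ← map_sub]; exact (_root_.map_ne_zero _).mpr hζ1
    have hζ0 : algebraMap k (HesseFunctionField lam) ζ ≠ 0 := by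
      have : ζ ≠ 0 := by rintro rfl; simp at hζ
      simpa using this
    have hW0 : W ≠ 0 := by
      rintro rfl
      rw [zero_mul, eq_comm, neg_eq_zero] at hW
      exact hμ0 (by simpa using hW)
    have h3K : (3 : HesseFunctionField lam) ∈ IntermediateField.adjoin k {W, Y} := by
      rw [← map_ofNat (algebraMap k _) 3]; exact hcK 3
    have hXK : 3 * (x + y) - algebraMap k _ lam ∈ IntermediateField.adjoin k {W, Y} := by
      rw [show 3 * (x + y) - algebraMap k _ lam = -algebraMap k _ μ / W by
        rw [← hW]; field_simp]
      exact div_mem (neg_mem (hcK μ)) hWK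
    set K := IntermediateField.adjoin k {W, Y}
    have h1 : x + y ∈ K := by
      rw [show x + y = (3 * (x + y) - algebraMap k _ lam + algebraMap k _ lam) / 3 by
        field_simp; ring]
      exact div_mem (add_mem hXK (hcK lam)) h3K
    have h2 : x + algebraMap k _ ζ ^ 2 * y ∈ K := by
      rw [show x + algebraMap k _ ζ ^ 2 * y = (Y * (3 * (x + y) - algebraMap k _ lam) /
        algebraMap k _ ζ ^ 2 + algebraMap k _ ζ * algebraMap k _ lam) / 3 by
          rw [hY]; field_simp; ring]
      exact div_mem (add_mem (div_mem (mul_mem hYK hXK) (pow_mem (hcK ζ) 2))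
        (mul_mem (hcK ζ) (hcK lam))) h3K
    have hyK : y ∈ K := by
      rw [show y = ((x + y) - (x + algebraMap k _ ζ ^ 2 * y)) / (1 - algebraMap k _ ζ ^ 2) by
        field_simp; ring]
      exact div_mem (sub_mem h1 h2) (sub_mem (one_mem K) (pow_mem (hcK ζ) 2))
    refine hgen K ?_ hyK
    rw [show x = x + y - y by ring]
    exact sub_mem h1 hyK

/-- For a cover of a Hesse cubic which is evenly ramified over some point, there are functions on
the covering curve satisfying `y² + (l' w + 1) y + w³ = 0`, with divisibility of the poles. -/
theorem exists_isPow_four_of_evenOver [IsAlgClosed k] {ζ lam μ : k} (h3 : (3 : k) ≠ 0)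
    (hζ : ζ ^ 2 + ζ + 1 = 0) (hlam : lam ^ 3 + 27 ≠ 0) (hμ : μ ^ 3 = lam ^ 3 + 27)
    (ι : Cover C (hesseCubic lam hlam)) {q : (hesseCubic lam hlam).Point} (hq : ι.EvenOver q) :
    ∃ W Y : C.FunctionField, W ∉ (algebraMap k _).range ∧
      Y ^ 2 + (algebraMap k _ (-3 * lam / μ) * W + 1) * Y + W ^ 3 = 0 ∧
      ∀ Q : C.Point, 1 < Q.val W → Q.IsPow 4 W := by
  obtain ⟨W₀, Y₀, h₀, htop₀⟩ := exists_generators_hesseCubic h3 hζ hlam hμ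
  have hμ0 : μ ≠ 0 := by
    rintro rfl
    exact hlam (by rw [← hμ]; simp)
  have hl : (-3 * lam / μ) ^ 3 + 27 ≠ 0 := by
    have : (-3 * lam / μ) ^ 3 + 27 = (9 / μ) ^ 3 := by
      field_simp
      rw [hμ]; ring
    rw [this]
    refine pow_ne_zero 3 (div_ne_zero ?_ hμ0)
    rw [show (9 : k) = 3 ^ 2 by norm_num]
    exact pow_ne_zero 2 h3
  set l := -3 * lam / μ
  obtain ⟨W, Y, h, htop, hpole⟩ : ∃ W Y : (hesseCubic lam hlam).FunctionField,
      Y ^ 2 + (algebraMap k _ l * W + 1) * Y + W ^ 3 = 0 ∧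
      IntermediateField.adjoin k {W, Y} = ⊤ ∧ 1 < q.val W := by
    rcases lt_or_ge 1 (q.val W₀) with hlt | hle
    · exact ⟨W₀, Y₀, h₀, htop₀, hlt⟩
    have hW₀ : W₀ ∉ (algebraMap k _).range := by
      rintro ⟨c, rfl⟩
      have hY₀ : Y₀ ∈ (algebraMap k (hesseCubic lam hlam).FunctionField).range := by
        by_contra hY
        refine transcendental_of_notMem_range hY ⟨X ^ 2 + Polynomial.C (l * c + 1) * X +
          Polynomial.C (c ^ 3), ?_, ?_⟩
        · refine Monic.ne_zero ?_
          monicity!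
        · simp only [map_add, map_mul, map_pow, map_one, aeval_X, aeval_C]
          exact h₀
      obtain ⟨d, rfl⟩ := hY₀
      obtain ⟨t, ht0, ht⟩ := q.exists_val_lt_one
      refine q.notMem_range_of_val_lt_one ht0 ht ?_
      have hle : IntermediateField.adjoin k {algebraMap k (hesseCubic lam hlam).FunctionField c,
          algebraMap k (hesseCubic lam hlam).FunctionField d} ≤ ⊥ := by
        rw [IntermediateField.adjoin_le_iff]
        rintro z (rfl | rfl)
        · exact (⊥ : IntermediateField k _).algebraMap_mem c
        · exact (⊥ : IntermediateField k _).algebraMap_mem d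
      rw [htop₀] at hle
      exact IntermediateField.mem_bot.mp (hle IntermediateField.mem_top)
    obtain ⟨W, Y, a, b, h, hpole, hgen, -⟩ := exists_reflection h3 hl hW₀ h₀ q hle
    refine ⟨W, Y, h, top_le_iff.mp ?_, hpole⟩
    rw [← htop₀, IntermediateField.adjoin_le_iff]
    have := hgen (IntermediateField.adjoin k {W, Y})
      (IntermediateField.subset_adjoin _ _ (by simp))
      (IntermediateField.subset_adjoin _ _ (by simp))
    rintro z (rfl | rfl)
    · exact this.1
    · exact this.2
  refine ⟨ι.pullback W, ι.pullback Y, ?_, ?_, fun Q hQ => ?_⟩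
  · obtain ⟨Q, rfl⟩ := ι.onPoints_surjective q
    refine Q.notMem_range_of_one_lt_val ?_
    have := (ι.val_pullback_lt Q (a := 1) (b := W)).mpr (by simpa using hpole)
    simpa using this
  · have := congrArg ι.pullback h
    simpa only [map_add, map_mul, map_pow, map_one, map_zero, AlgHom.commutes] using this
  · have hQ' : 1 < (ι.onPoints Q).val W := by
      have := (ι.val_pullback_lt Q (a := 1) (b := W)).mp (by simpa using hQ)
      simpa using this
    have hQq : ι.onPoints Q = q := Point.eq_of_pole h htop hQ' hpole
    -- At infinity W has the value of (Y / W)², and even ramification makes the value of Y / W a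
    -- square upstairs. This is the source of the exponent 4.
    obtain ⟨a, ha⟩ := ι.isPow_two_of_even Q (hq Q hQq) (Y / W)
    refine ⟨a, ?_⟩
    rw [show 4 = 2 * 2 from rfl, pow_mul, ← ha, ← map_pow, ← map_pow, ι.val_pullback_eq, map_pow,
      map_div₀, div_pow, Point.val,
      Valuation.sq_eq_cube_of_pole _ ((ι.onPoints Q).val_algebraMap_le_one l) h hQ', pow_succ,
      mul_div_cancel_left₀]
    exact pow_ne_zero 2 (zero_lt_one.trans hQ').ne'

end SmoothCurve

/-! ### Double covers and even ramification -/

namespace SmoothCurve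

variable {k : Type u} [Field k] {B C D E : SmoothCurve k}

/-- A double cover is generated by a square root, and maps out of it are given by square roots. -/
theorem Cover.exists_sqrt_of_degree_two (h2 : (2 : k) ≠ 0) (p : Cover E B) (hp : p.degree = 2) :
    ∃ (s : E.FunctionField) (g : B.FunctionField), g ≠ 0 ∧ s ^ 2 = p.pullback g ∧
      ∀ {D : SmoothCurve k} (f : Cover D B) (r : D.FunctionField), r ^ 2 = f.pullback g →
        ∃ f' : Cover D E, p.comp f' = f := by
  letI : Algebra B.FunctionField E.FunctionField := p.extension
  haveI : Module.Finite B.FunctionField E.FunctionField := p.finite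
  have hfin : Module.finrank B.FunctionField E.FunctionField = 2 := hp
  have half : ∀ {A : SmoothCurve k}, (2 : A.FunctionField) ≠ 0 := fun {A} => by
    rw [← map_ofNat (algebraMap k _) 2]; simpa using h2
  obtain ⟨α, hα⟩ : ∃ α : E.FunctionField, α ∉ (algebraMap B.FunctionField E.FunctionField).range := by
    by_contra! hall
    have htop : (⊥ : Subalgebra B.FunctionField E.FunctionField) = ⊤ :=
      top_le_iff.mp fun x _ => Algebra.mem_bot.mpr (hall x)
    rw [Subalgebra.bot_eq_top_iff_finrank_eq_one, hfin] at htop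
    omega
  have hint : IsIntegral B.FunctionField α := Algebra.IsIntegral.isIntegral α
  have hdeg : (minpoly B.FunctionField α).natDegree = 2 := by
    have h1 := minpoly.natDegree_le (A := B.FunctionField) α
    rw [hfin] at h1
    have h2 := minpoly.natDegree_pos hint
    have h3 : (minpoly B.FunctionField α).natDegree ≠ 1 := fun h =>
      hα (minpoly.mem_range_of_degree_eq_one _ _
        ((degree_eq_iff_natDegree_eq (minpoly.ne_zero hint)).mpr h))
    omega
  have hmonic := minpoly.monic hint
  set b := (minpoly B.FunctionField α).coeff 1
  set c := (minpoly B.FunctionField α).coeff 0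
  have hM : minpoly B.FunctionField α = X ^ 2 + Polynomial.C b * X + Polynomial.C c := by
    have h1 := (minpoly B.FunctionField α).as_sum_range_C_mul_X_pow
    have h2 : (minpoly B.FunctionField α).coeff 2 = 1 := by rw [← hdeg]; exact hmonic
    rw [hdeg, Finset.sum_range_succ, Finset.sum_range_succ, Finset.sum_range_one, h2] at h1
    rw [h1]
    simp only [pow_zero, pow_one, map_one]
    ring
  have hadj : Algebra.adjoin B.FunctionField {α} = ⊤ := by
    rw [← IntermediateField.adjoin_simple_toSubalgebra_of_isAlgebraic hint.isAlgebraic,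
      (Field.primitive_element_iff_minpoly_natDegree_eq _ _).mpr (hdeg.trans hfin.symm),
      IntermediateField.top_toSubalgebra]
  have hαeq : α ^ 2 + p.pullback b * α + p.pullback c = 0 := by
    have h1 := minpoly.aeval B.FunctionField α
    rw [hM] at h1
    simp only [map_add, map_mul, map_pow, aeval_X, aeval_C] at h1
    exact h1
  -- Completing the square in the minimal polynomial of α.
  have hs : (α + p.pullback b / 2) ^ 2 = p.pullback (b ^ 2 / 4 - c) := by
    have h2E : (2 : E.FunctionField) ≠ 0 := half
    rw [map_sub, map_div₀, map_pow, map_ofNat, show (4 : E.FunctionField) = 2 ^ 2 by norm_num]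
    field_simp
    linear_combination 4 * hαeq
  refine ⟨α + p.pullback b / 2, b ^ 2 / 4 - c, ?_, hs, ?_⟩
  · intro h0
    rw [h0, map_zero] at hs
    have h1 : α + p.pullback b / 2 = 0 := by simpa using hs
    refine hα ⟨-b / 2, ?_⟩
    change p.pullback (-b / 2) = α
    rw [map_div₀, map_neg, map_ofNat]
    linear_combination -h1
  · intro D f r hr
    letI : Algebra B.FunctionField D.FunctionField := f.extension
    have h2D : (2 : D.FunctionField) ≠ 0 := half
    let pb := PowerBasis.ofAdjoinEqTop hint hadj
    have hgen : pb.gen = α := PowerBasis.ofAdjoinEqTop_gen hint hadj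
    let φ := pb.lift (r - f.pullback b / 2) (by
      rw [hgen, hM]
      simp only [map_add, map_mul, map_pow, aeval_X, aeval_C]
      change (r - f.pullback b / 2) ^ 2 + f.pullback b * (r - f.pullback b / 2) + f.pullback c = 0
      rw [map_sub, map_div₀, map_pow, map_ofNat, show (4 : D.FunctionField) = 2 ^ 2 by norm_num] at hr
      field_simp at hr ⊢
      linear_combination hr)
    have hφ : ∀ x, φ (p.pullback x) = f.pullback x := fun x => φ.commutes x
    refine ⟨⟨{ φ.toRingHom with commutes' := fun x => ?_ }⟩, ?_⟩
    · change φ (algebraMap k _ x) = _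
      rw [← p.pullback.commutes, hφ, f.pullback.commutes]
    · change Cover.mk _ = f
      congr 1
      exact AlgHom.ext hφ

/-- If a square root of `g` generates a double cover, then the valuation of `g` is even at all the
points outside of the branch locus. -/
theorem Cover.isPow_two_of_notMem_branchLocus [IsAlgClosed k] (p : Cover E B) {s : E.FunctionField}
    {g : B.FunctionField} (hg : g ≠ 0) (hs : s ^ 2 = p.pullback g) {P : B.Point}
    (hP : P ∉ p.branchLocus) : P.IsPow 2 g := by
  obtain ⟨R, rfl⟩ := p.onPoints_surjective P
  have he : p.ramificationIndex R = 1 := by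
    have h1 := p.ramificationIndex_ne_zero R
    have h2 : ¬ 1 < p.ramificationIndex R := fun h => hP ⟨R, h, rfl⟩
    omega
  obtain ⟨π, hπ⟩ := (p.onPoints R).exists_isUniformizer
  obtain ⟨ϖ, hϖ⟩ := R.exists_isUniformizer
  have h1 := (p.val_ramificationIndex R hπ hϖ).2
  rw [he, pow_one] at h1
  have hs0 : s ≠ 0 := by
    rintro rfl
    rw [zero_pow two_ne_zero, eq_comm] at hs
    exact hg (by simpa using hs)
  obtain ⟨n, hn⟩ := hϖ.exists_zpow s hs0
  refine ⟨π ^ n, ?_⟩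
  rw [← map_pow, ← p.val_pullback_eq, ← hs, map_pow, map_pow, map_pow, map_zpow₀, map_zpow₀, h1, hn]

/-- The ramification index is even if the pullback of a uniformizing parameter has even
valuation. -/
theorem Cover.even_ramificationIndex [IsAlgClosed k] (f : Cover C B) (Q : C.Point)
    {π : B.FunctionField} (hπ : (f.onPoints Q).IsUniformizer π) (h : Q.IsPow 2 (f.pullback π)) :
    Even (f.ramificationIndex Q) := by
  obtain ⟨ϖ, hϖ⟩ := Q.exists_isUniformizer
  obtain ⟨-, h1⟩ := f.val_ramificationIndex Q hπ hϖ
  obtain ⟨a, ha⟩ := h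
  have ha0 : a ≠ 0 := by
    rintro rfl
    rw [map_zero, zero_pow two_ne_zero, h1] at ha
    exact pow_ne_zero _ hϖ.val_pos.ne' ha
  obtain ⟨n, hn⟩ := hϖ.exists_zpow a ha0
  rw [h1, hn, ← zpow_natCast, ← zpow_natCast, ← zpow_mul, hϖ.zpow_inj] at ha
  rw [← Int.even_coe_nat, ha]
  exact (even_two.mul_left n)

/-- Ramification indices are multiplicative along points which are not ramified over the base. -/
theorem Cover.ramificationIndex_eq_comp [IsAlgClosed k] (p : Cover E B) (f : Cover C E) (Q : C.Point)
    (h : p.ramificationIndex (f.onPoints Q) = 1) :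
    f.ramificationIndex Q = (p.comp f).ramificationIndex Q := by
  obtain ⟨π, hπ⟩ := ((p.comp f).onPoints Q).exists_isUniformizer
  obtain ⟨σ, hσ⟩ := (f.onPoints Q).exists_isUniformizer
  obtain ⟨ϖ, hϖ⟩ := Q.exists_isUniformizer
  have h1 := ((p.comp f).val_ramificationIndex Q hπ hϖ).2
  have h2 := (f.val_ramificationIndex Q hσ hϖ).2
  have h3 := (p.val_ramificationIndex (f.onPoints Q) (π := π) hπ hσ).2
  rw [h, pow_one, ← f.val_pullback_eq, h2] at h3
  change Q.val (f.pullback (p.pullback π)) = _ at h1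
  rw [h1, ← zpow_natCast, ← zpow_natCast, hϖ.zpow_inj] at h3
  exact_mod_cast h3.symm

theorem Point.isUniformizer_of_valuation {P : C.Point}
    (v : Valuation C.FunctionField (WithZero (Multiplicative ℤ))) (hP : P.localRing = v.valuationSubring) {π : C.FunctionField}
    (hπ : v π = WithZero.exp (-1)) : P.IsUniformizer π := by
  have heq : v.IsEquiv P.val := by
    have := Valuation.isEquiv_valuation_valuationSubring v
    rw [Point.val, hP]
    exact this
  refine ⟨?_, ?_, fun f hf => ?_⟩
  · rintro rfl
    rw [map_zero] at hπ
    exact WithZero.exp_ne_zero hπ.symm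
  · refine heq.lt_one_iff_lt_one.mp ?_
    rw [hπ, ← WithZero.exp_zero, WithZero.exp_lt_exp]
    norm_num
  · refine ⟨-(v f).log, ?_⟩
    rw [← map_zpow₀]
    refine heq.eq_iff.mp ?_
    have hf0 : v f ≠ 0 := (Valuation.ne_zero_iff v).mpr hf
    rw [map_zpow₀, hπ, ← WithZero.exp_zsmul, ← WithZero.exp_log hf0]
    simp

/-! ### The projective line and the five images of the flexes -/

namespace projectiveLine

theorem isUniformizer_affinePoint (a : k) :
    (affinePoint a).IsUniformizer (coord - algebraMap k (projectiveLine k).FunctionField a) := by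
  have h : (coord - algebraMap k (projectiveLine k).FunctionField a : RatFunc k) =
      algebraMap k[X] (RatFunc k) (X - Polynomial.C a) := by
    rw [map_sub, RatFunc.algebraMap_X, RatFunc.algebraMap_C]
    rfl
  refine Point.isUniformizer_of_valuation (C := projectiveLine k)
    ((primeAt a).valuation (RatFunc k)) rfl ?_
  refine (congrArg ((primeAt a).valuation (RatFunc k)) h).trans
    (((primeAt a).valuation_of_algebraMap _).trans ?_)
  exact (primeAt a).intValuation_singleton (X_sub_C_ne_zero a) rfl

open Classical in
theorem isUniformizer_pointAtInfinity :
    (pointAtInfinity (k := k)).IsUniformizer coord⁻¹ := by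
  refine Point.isUniformizer_of_valuation (C := projectiveLine k) (RatFunc.inftyValuation k) rfl ?_
  have h1 : RatFunc.inftyValuation k (coord⁻¹ : RatFunc k) =
      (RatFunc.inftyValuation k (RatFunc.X : RatFunc k))⁻¹ := map_inv₀ _ _
  refine h1.trans ?_
  rw [RatFunc.inftyValuation.X, WithZero.exp_neg]

theorem affinePoint_injective : Function.Injective (affinePoint (k := k)) := by
  intro a b hab
  by_contra hne
  have h1 := (isUniformizer_affinePoint a).lt_one
  have h2 := (isUniformizer_affinePoint b).lt_one
  rw [hab] at h1
  have h3 := Valuation.map_sub_lt _ h1 h2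
  rw [sub_sub_sub_cancel_left, ← map_sub, Point.val_algebraMap] at h3
  · exact h3.ne rfl
  · exact sub_ne_zero.mpr (Ne.symm hne)

theorem affinePoint_ne_pointAtInfinity (a : k) : affinePoint a ≠ pointAtInfinity := by
  intro h
  have h1 := (isUniformizer_affinePoint a).lt_one
  have h2 := (isUniformizer_pointAtInfinity (k := k)).lt_one
  rw [← h, map_inv₀] at h2
  have h3 : (affinePoint a).val coord ≤ 1 := by
    rw [show (coord : (projectiveLine k).FunctionField) =
      (coord - algebraMap k _ a) + algebraMap k _ a by ring]
    exact Valuation.map_add_le _ h1.le (Point.val_algebraMap_le_one _ _)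
  have h4 : (coord : (projectiveLine k).FunctionField) ≠ 0 := RatFunc.X_ne_zero
  exact h2.not_ge ((one_le_inv₀ (Point.val_pos _ h4)).mpr h3)

end projectiveLine

open projectiveLine

theorem flexImages_eq {ζ : k} (hζ : ζ ≠ 0) : flexImages ζ =
    insert pointAtInfinity (affinePoint '' {0, 1 / -ζ, 1 / -ζ ^ 2, 1 / -1}) := by
  have h2 : ζ ^ 2 ≠ 0 := pow_ne_zero 2 hζ
  simp only [flexImages, point, Set.image_insert_eq, Set.image_singleton, neg_eq_zero, hζ, h2,
    one_ne_zero, if_false, if_true, div_one]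
  ext P
  simp only [Set.mem_insert_iff, Set.mem_singleton_iff]
  tauto

theorem ncard_flexImages {ζ : k} (hζ : IsPrimitiveRoot ζ 3) : (flexImages ζ).ncard = 5 := by
  have hζ0 : ζ ≠ 0 := hζ.ne_zero (by norm_num)
  have h1 : ζ ≠ 1 := hζ.ne_one (by norm_num)
  have h2 : ζ ^ 2 ≠ 1 := hζ.pow_ne_one_of_pos_of_lt (by norm_num) (by norm_num)
  have h3 : ζ ≠ ζ ^ 2 := fun h => h1 (mul_left_cancel₀ hζ0 (by rw [mul_one, ← sq, ← h]))
  have h20 : ζ ^ 2 ≠ 0 := pow_ne_zero 2 hζ0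
  rw [flexImages_eq hζ0, Set.ncard_insert_of_notMem, Set.ncard_image_of_injective _
    affinePoint_injective, Set.ncard_insert_of_notMem, Set.ncard_insert_of_notMem, Set.ncard_pair]
  · simpa [div_eq_mul_inv] using h2
  · simp only [Set.mem_insert_iff, Set.mem_singleton_iff, not_or, one_div, inv_neg, neg_inj, inv_inj,
      inv_one]
    exact ⟨h3, by simpa using h1⟩
  · simp only [Set.mem_insert_iff, Set.mem_singleton_iff, not_or]
    refine ⟨?_, ?_, ?_⟩ <;> simp [hζ0]
  · rintro ⟨a, -, ha⟩
    exact affinePoint_ne_pointAtInfinity a ha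

theorem exists_mem_flexImages_notMem {ζ : k} (hζ : IsPrimitiveRoot ζ 3)
    {S : Set (projectiveLine k).Point} (hS : S.ncard = 4) : ∃ P ∈ flexImages ζ, P ∉ S := by
  by_contra! h
  have hfin : S.Finite := Set.finite_of_ncard_ne_zero (by omega)
  have := Set.ncard_le_ncard h hfin
  rw [ncard_flexImages hζ] at this
  omega

/-- The divisibility properties of the function produced by the tripling mean that it is evenly
ramified over the images of the flexes. -/
theorem even_ramificationIndex_of_flexImages [IsAlgClosed k] {ζ : k} (hζ : IsPrimitiveRoot ζ 3)
    (f : Cover C (projectiveLine k))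
    (h : ∀ (Q : C.Point) (z : k), z ^ 3 = 1 → Q.IsPow 2 (f.pullback coord + algebraMap k _ z))
    (h0 : ∀ Q : C.Point, Q.val (f.pullback coord) < 1 → Q.IsPow 2 (f.pullback coord))
    (Q : C.Point) (hQ : f.onPoints Q ∈ flexImages ζ) : Even (f.ramificationIndex Q) := by
  have hζ3 : ζ ^ 3 = 1 := hζ.pow_eq_one
  rw [flexImages_eq (hζ.ne_zero (by norm_num))] at hQ
  have root : ∀ z : k, z ^ 3 = 1 → f.onPoints Q = affinePoint (1 / -z) →
      Even (f.ramificationIndex Q) := by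
    intro z hz hP
    have hu := isUniformizer_affinePoint (1 / -z)
    rw [← hP] at hu
    refine f.even_ramificationIndex Q hu ?_
    rw [map_sub, f.pullback.commutes, show 1 / -z = -z⁻¹ by rw [one_div, inv_neg], map_neg,
      sub_neg_eq_add]
    exact h Q _ (by rw [inv_pow, hz, inv_one])
  rcases hQ with hP | ⟨a, ha, hP⟩
  · have hu := isUniformizer_pointAtInfinity (k := k)
    rw [← hP] at hu
    refine f.even_ramificationIndex Q hu ?_
    have hlt := (f.val_pullback_lt_one Q).mpr hu.lt_one
    have hc0 : f.pullback coord ≠ 0 := by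
      have : (coord : (projectiveLine k).FunctionField) ≠ 0 := RatFunc.X_ne_zero
      simpa using this
    have hgt : 1 < Q.val (f.pullback coord) := by
      rw [map_inv₀, map_inv₀] at hlt
      exact (inv_lt_one₀ (Q.val_pos hc0)).mp hlt
    -- At a pole of the coordinate, adding 1 does not change the value, so the hypothesis at z = 1
    -- also covers the point at infinity.
    obtain ⟨b, hb⟩ := h Q 1 (one_pow 3)
    rw [Valuation.map_add_eq_of_lt_left _ ((Q.val_algebraMap_le_one _).trans_lt hgt)] at hb
    exact ⟨b⁻¹, by rw [map_inv₀, map_inv₀, hb, map_inv₀, inv_pow]⟩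
  · simp only [Set.mem_insert_iff, Set.mem_singleton_iff] at ha
    rcases ha with rfl | rfl | rfl | rfl
    · have hu := isUniformizer_affinePoint (0 : k)
      rw [hP, map_zero, sub_zero] at hu
      exact f.even_ramificationIndex Q hu (h0 Q ((f.val_pullback_lt_one Q).mpr hu.lt_one))
    · exact root ζ hζ3 hP.symm
    · exact root (ζ ^ 2) (by rw [← pow_mul, mul_comm, pow_mul, hζ3, one_pow]) hP.symm
    · exact root 1 (one_pow 3) hP.symm

end SmoothCurve

/-! ### From the function `t` to the curve y² + y + w³ = 0 -/

namespace SmoothCurve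

variable {k : Type u} [Field k] {C : SmoothCurve k}

theorem Point.IsPow.mul {Q : C.Point} {n : ℕ} {f g : C.FunctionField} (hf : Q.IsPow n f)
    (hg : Q.IsPow n g) : Q.IsPow n (f * g) := by
  obtain ⟨a, ha⟩ := hf
  obtain ⟨b, hb⟩ := hg
  exact ⟨a * b, by rw [map_mul, map_mul, mul_pow, ha, hb]⟩

theorem Point.IsPow.of_mul {Q : C.Point} {m n : ℕ} {f : C.FunctionField} (hf : Q.IsPow (m * n) f) :
    Q.IsPow n f := by
  obtain ⟨a, ha⟩ := hf
  exact ⟨a ^ m, by rw [ha, map_pow, pow_mul]⟩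

/-- From a function which is evenly ramified over the images of the flexes other than the origin to
the double cover of the projective line branched there, as a curve `y² + y + w³ = 0`. -/
theorem exists_cover_of_isPow [IsAlgClosed k] (h2 : (2 : k) ≠ 0) (h3 : (3 : k) ≠ 0) {ζ lam : k}
    (hζ : ζ ^ 2 + ζ + 1 = 0) (hlam : lam ^ 3 + 27 ≠ 0) {t : C.FunctionField}
    (ht : t ∉ (algebraMap k _).range)
    (hflex : ∀ (Q : C.Point) (z : k), z ^ 3 = 1 → Q.IsPow 2 (t + algebraMap k _ z))
    (hzero : ∀ Q : C.Point, Q.val (3 * t - algebraMap k _ lam) < 1 →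
      Q.IsPow 4 (3 * t - algebraMap k _ lam)) :
    ∃ (C' : SmoothCurve k) (τ : Cover C' C) (W Y : C'.FunctionField), τ.IsImmediate ∧
      W ∉ (algebraMap k _).range ∧ Y ^ 2 + (algebraMap k _ 0 * W + 1) * Y + W ^ 3 = 0 ∧
      ∀ Q : C'.Point, 1 < Q.val W → Q.IsPow 4 W := by
  have hζ3 : ζ ^ 3 = 1 := by linear_combination (ζ - 1) * hζ
  have hprod : t ^ 3 + 1 = (t + algebraMap k _ 1) * (t + algebraMap k _ ζ) *
      (t + algebraMap k _ (ζ ^ 2)) := by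
    have hζF := congrArg (algebraMap k C.FunctionField) hζ
    have hζ3F := congrArg (algebraMap k C.FunctionField) hζ3
    simp only [map_add, map_pow, map_one, map_zero] at hζF hζ3F ⊢
    linear_combination (-t ^ 2 - t) * hζF - (t + 1) * hζ3F
  have hne : ∀ c : k, t + algebraMap k _ c ≠ 0 := fun c h =>
    ht ⟨-c, by rw [map_neg]; linear_combination -h⟩
  obtain ⟨C', τ, hτ, s, hs⟩ := exists_isImmediate_pow_eq (k := k) Nat.prime_two
    (by exact_mod_cast h2) (g := t ^ 3 + 1)
    (by rw [hprod]; exact mul_ne_zero (mul_ne_zero (hne _) (hne _)) (hne _))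
    (fun Q => by
      rw [hprod]
      exact ((hflex Q 1 (one_pow 3)).mul (hflex Q ζ hζ3)).mul
        (hflex Q (ζ ^ 2) (by rw [← pow_mul, mul_comm, pow_mul, hζ3, one_pow])))
  -- A cube root of 4 rescales s² = T³ + 1 to the required form: Y = (s - 1)/2 gives Y² + Y = T³/4 =
  -- -(-T/κ)³.
  obtain ⟨κ, hκ⟩ := IsAlgClosed.exists_pow_nat_eq (4 : k) (n := 3) (by norm_num)
  have h4 : (4 : k) ≠ 0 := by
    rw [show (4 : k) = 2 ^ 2 by norm_num]; exact pow_ne_zero 2 h2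
  have hκ0 : κ ≠ 0 := by
    rintro rfl
    exact h4 (by rw [← hκ]; simp)
  set A := algebraMap k C'.FunctionField with hA
  have h2F : (2 : C'.FunctionField) ≠ 0 := by
    rw [← map_ofNat A 2]; simpa using h2
  have h3F : (3 : C'.FunctionField) ≠ 0 := by
    rw [← map_ofNat A 3]; simpa using h3
  have hκF : A κ ^ 3 = 2 ^ 2 := by
    rw [← map_pow, hκ, map_ofNat]; norm_num
  have hκF0 : A κ ≠ 0 := by simpa using hκ0
  set T := τ.pullback t with hT
  have hTc : T ∉ A.range := by
    rintro ⟨c, hc⟩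
    refine ht ⟨c, τ.pullback.injective ?_⟩
    exact (τ.pullback.commutes c).trans hc
  have hs' : s ^ 2 = T ^ 3 + 1 := by rw [hs, map_add, map_pow, map_one]
  have hcurve : ((s - 1) / 2) ^ 2 + (A 0 * (-T / A κ) + 1) * ((s - 1) / 2) + (-T / A κ) ^ 3 = 0 := by
    rw [div_pow (-T) (A κ) 3, hκF, map_zero]
    field_simp
    linear_combination A κ * hs'
  have hWc : -T / A κ ∉ A.range := by
    rintro ⟨c, hc⟩
    refine hTc ⟨-(c * κ), ?_⟩
    rw [map_neg, map_mul, hc]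
    field_simp
  have hSc : 3 * T - A lam ∉ A.range := by
    rintro ⟨c, hc⟩
    refine hTc ⟨(c + lam) / 3, ?_⟩
    rw [map_div₀, map_add, hc, map_ofNat]
    field_simp
    ring
  obtain ⟨Q₀, hQ₀⟩ := exists_point_val_lt_one hSc
  have hA3κ : ∀ Q : C'.Point, Q.val (-(3 * A κ)) = 1 := fun Q => by
    rw [Valuation.map_neg, map_mul, Q.val_ofNat h3, Q.val_algebraMap hκ0, one_mul]
  have hshift : 3 * T - A lam = -(3 * A κ) * (-T / A κ - A (-lam / (3 * κ))) := by
    rw [map_div₀, map_neg, map_mul, map_ofNat]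
    field_simp
    ring
  have hval : ∀ Q : C'.Point, Q.val (-T / A κ - A (-lam / (3 * κ))) = Q.val (3 * T - A lam) :=
    fun Q => by rw [hshift, map_mul, hA3κ, one_mul]
  have hW₀ : Q₀.val (-T / A κ) ≤ 1 := by
    rw [show -T / A κ = (-T / A κ - A (-lam / (3 * κ))) + A (-lam / (3 * κ)) by ring]
    exact Valuation.map_add_le _ (by rw [hval]; exact hQ₀.le) (Q₀.val_algebraMap_le_one _)
  have h27 : (27 : k) ≠ 0 := by
    rw [show (27 : k) = 3 ^ 3 by norm_num]; exact pow_ne_zero 3 h3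
  obtain ⟨W, Y, a, b, hWY, hpole, -, hab, ha, hpoles⟩ := exists_reflection h3 (l := 0)
    (by simpa using h27) hWc hcurve Q₀ hW₀
  have haeq : a = -lam / (3 * κ) := by
    by_contra hne
    have h1 := Valuation.map_sub_lt _ (hval Q₀ ▸ hQ₀) ha
    rw [sub_sub_sub_cancel_left, ← map_sub, Q₀.val_algebraMap (sub_ne_zero.mpr hne)] at h1
    exact h1.ne rfl
  -- Vanishing would mean that T = lam/3 is a branch point of the double cover, that is lam³ = -27.
  have hb : 2 * b + 0 * a + 1 ≠ 0 := by
    intro h0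
    apply hlam
    have h5 : a ^ 3 * (27 * 4) = -lam ^ 3 := by
      rw [haeq, ← hκ]
      field_simp
      ring
    linear_combination h5 + 27 * (2 * b + 1) * h0 - 27 * 4 * hab
  refine ⟨C', τ, W, Y, hτ, Q₀.notMem_range_of_one_lt_val hpole, hWY, fun Q hQ => ?_⟩
  have h1 := hpoles Q hQ hb
  rw [haeq, hval Q] at h1
  have hlt : Q.val (3 * T - A lam) < 1 := by
    by_contra! hge
    exact (one_lt_mul_of_lt_of_le hQ (one_le_pow₀ hge)).ne' h1
  have hST : 3 * T - A lam = τ.pullback (3 * t - algebraMap k _ lam) := by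
    rw [map_sub, map_mul, map_ofNat, τ.pullback.commutes]
  obtain ⟨c, hc⟩ : Q.IsPow 4 (3 * T - A lam) := by
    rw [hST] at hlt ⊢
    exact (hzero _ ((τ.val_pullback_lt_one Q).mp hlt)).pullback
  -- W has the value of (3 T - lam)⁻², and 3 T - lam that of c⁴; so W has the value of c⁻⁸, more
  -- than enough.
  refine ⟨(c ^ 2)⁻¹, ?_⟩
  rw [eq_inv_of_mul_eq_one_left h1, hc, map_inv₀, inv_pow, map_pow, ← pow_mul, ← pow_mul]

end SmoothCurve

end

/-! ### Assembly of the covers -/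

open SmoothCurve

theorem mainTheorem7 {k : Type u} [Field k] [IsAlgClosed k] (h2 : (2 : k) ≠ 0) (h3 : (3 : k) ≠ 0)
    (ζ : k) (hζ : IsPrimitiveRoot ζ 3)
    (E₀' : SmoothCurve k) (π₀' : SmoothCurve.Cover E₀' (SmoothCurve.projectiveLine k))
    (hπ_degree : π₀'.degree = 2)
    (hπ_card : π₀'.branchLocus.ncard = 4)
    (hπ_branch : π₀'.branchLocus ⊆ SmoothCurve.flexImages ζ)
    (lam : k) (hlam : lam ^ 3 + 27 ≠ 0)
    (C : SmoothCurve k) (ι : SmoothCurve.Cover C (SmoothCurve.hesseCubic lam hlam))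
    (hι_degree : ι.degree = 2)
    (hι_even : ∃ q ∈ ι.branchLocus, ι.EvenOver q) :
    ∃ (C' : SmoothCurve k) (τ : SmoothCurve.Cover C' C) (ι' : SmoothCurve.Cover C' E₀'),
      τ.IsUnramified ∧ Function.Surjective ι'.onPoints ∧
        ∃ q ∈ ι'.branchLocus, ι'.EvenOver q := by
  have hζ' : ζ ^ 2 + ζ + 1 = 0 := by
    have h1 : ζ - 1 ≠ 0 := sub_ne_zero.mpr (hζ.ne_one (by norm_num))
    apply mul_left_cancel₀ h1
    linear_combination hζ.pow_eq_one
  obtain ⟨q, -, hq⟩ := hι_even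
  obtain ⟨μ, hμ⟩ := IsAlgClosed.exists_pow_nat_eq (lam ^ 3 + 27) (n := 3) (by norm_num)
  obtain ⟨W, Y, hWc, hWY, hpole⟩ := exists_isPow_four_of_evenOver h3 hζ' hlam hμ ι hq
  obtain ⟨C₁, τ₁, t₁, hτ₁, ht₁, hflex₁, hzero₁⟩ :=
    exists_tripling h3 hζ' hlam hμ rfl hWc hWY hpole
  obtain ⟨C₂, τ₂, W₂, Y₂, hτ₂, hW₂c, hWY₂, hpole₂⟩ :=
    exists_cover_of_isPow h2 h3 hζ' hlam ht₁ hflex₁ hzero₁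
  have h27 : (0 : k) ^ 3 + 27 ≠ 0 := by
    rw [show (0 : k) ^ 3 + 27 = 3 ^ 3 by norm_num]; exact pow_ne_zero 3 h3
  obtain ⟨C₃, τ₃, t, hτ₃, ht, hflex, hzero⟩ :=
    -- For l = 0 the parameter change fixes l, with μ = 3, and the value l/3 becomes the fifth point
    -- 0.
    exists_tripling (l := 0) (l' := 0) (μ := 3) h3 hζ' h27 (by norm_num) (by simp) hW₂c hWY₂ hpole₂
  have hzero' : ∀ Q : C₃.Point, Q.val t < 1 → Q.IsPow 2 t := by
    intro Q hQ
    have h1 : Q.val (3 * t - algebraMap k _ 0) = Q.val t := by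
      rw [map_zero, sub_zero, map_mul, Q.val_ofNat h3, one_mul]
    obtain ⟨a, ha⟩ := (hzero Q (by rwa [h1])).of_mul (m := 2) (n := 2)
    exact ⟨a, by rw [← h1, ha]⟩
  have htr := transcendental_of_notMem_range ht
  have hflexf : ∀ (Q : C₃.Point) (z : k), z ^ 3 = 1 →
      Q.IsPow 2 ((coverOfTranscendental t htr).pullback projectiveLine.coord + algebraMap k _ z) :=
    fun Q z hz => by rw [coverOfTranscendental_coord]; exact hflex Q z hz
  have hzerof : ∀ Q : C₃.Point,
      Q.val ((coverOfTranscendental t htr).pullback projectiveLine.coord) < 1 →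
        Q.IsPow 2 ((coverOfTranscendental t htr).pullback projectiveLine.coord) :=
    fun Q hQ => by rw [coverOfTranscendental_coord] at hQ ⊢; exact hzero' Q hQ
  generalize coverOfTranscendental t htr = f at hflexf hzerof
  have heven := even_ramificationIndex_of_flexImages hζ f hflexf hzerof
  obtain ⟨s, g, hg0, hs, hlift⟩ := π₀'.exists_sqrt_of_degree_two h2 hπ_degree
  obtain ⟨C₄, τ₄, hτ₄, r, hr⟩ := exists_isImmediate_pow_eq (k := k) Nat.prime_two
    (by exact_mod_cast h2) (g := f.pullback g) (by simpa using hg0) (fun Q => by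
      by_cases hQ : f.onPoints Q ∈ flexImages ζ
      · exact f.isPow_two_of_even Q (heven Q hQ) g
      · exact (π₀'.isPow_two_of_notMem_branchLocus hg0 hs fun h => hQ (hπ_branch h)).pullback)
  have heven₄ := even_ramificationIndex_of_flexImages hζ (f.comp τ₄)
    (fun Q z hz => by
      have h := (hflexf (τ₄.onPoints Q) z hz).pullback
      rwa [map_add, τ₄.pullback.commutes] at h)
    (fun Q hQ => (hzerof _ ((τ₄.val_pullback_lt_one Q).mp hQ)).pullback)
  obtain ⟨ι', hι'⟩ := hlift (f.comp τ₄) r hr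
  obtain ⟨P, hP, hPB⟩ := exists_mem_flexImages_notMem hζ hπ_card
  obtain ⟨R, rfl⟩ := π₀'.onPoints_surjective P
  have hR : π₀'.ramificationIndex R = 1 := by
    have h1 := π₀'.ramificationIndex_ne_zero R
    have h2 : ¬ 1 < π₀'.ramificationIndex R := fun h => hPB ⟨R, h, rfl⟩
    omega
  have hevenR : ι'.EvenOver R := by
    rintro Q rfl
    -- As π₀' is unramified at R, the index of ι' is that of the map to the line, which is even over
    -- the fifth point.
    rw [π₀'.ramificationIndex_eq_comp ι' Q hR, hι']
    refine heven₄ Q ?_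
    rw [← hι']
    exact hP
  refine ⟨C₄, ((τ₁.comp τ₂).comp τ₃).comp τ₄, ι',
    (((hτ₁.comp hτ₂).comp hτ₃).comp hτ₄).isUnramified, ι'.onPoints_surjective, R, ?_, hevenR⟩
  -- R is a branch point because some point lies over it, with an index that is even and non-zero.
  obtain ⟨Q, hQ⟩ := ι'.onPoints_surjective R
  refine ⟨Q, ?_, hQ⟩
  have h1 := ι'.ramificationIndex_ne_zero Q
  obtain ⟨m, hm⟩ := hevenR Q hQ
  change 1 < ι'.ramificationIndex Q
  omega
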